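/- Let $\beta\in\{1,2\}$. For each $N\ge 1$ let $E_N$ be an $N\times N$ matrix, real symmetric if $\beta=1$ and complex Hermitian if $\beta=2$, with eigenvalues $\lambda_1(E_N),\dots,\lambda_N(E_N)$. Let $m_N^{(\beta)}$ be the Haar probability measure on the orthogonal group $\mathcal O_N$ ($\beta=1$) or the unitary group $\mathcal U_N$ ($\beta=2$). For $\theta\in\mathbb R$ let $$I_N^{(\beta)}(\theta,E_N)=\int \exp\{N\,\mathrm{tr}(UD_NU^*E_N)\}\,dm_N^{(\beta)}(U),\qquad D_N=\mathrm{diag}(\theta,0,\dots,0).$$ Assume that 1. the spectral measures $\frac1N\sum_{i=1}^N\delta_{\lambda_i(E_N)}$ converge weakly to a compactly supported probability measure $\mu_E$ on $\mathbb R$; 2. $\min_i\lambda_i(E_N)\to\lambda_{\min}$ and $\max_i\lambda_i(E_N)\to\lambda_{\max}$, where $\lambda_{\min},\lambda_{\max}\in\mathbb R$. Let $H_{\mu_E}(z)=\int\frac{d\mu_E(\lambda)}{z-\lambda}$ for $z$ outside the support of $\mu_E$. Let $A$ be the set of real points outside the convex hull of the support of $\mu_E$, let $K_{\mu_E}$ be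 the inverse of the injective map $H_{\mu_E}:A\to H_{\mu_E}(A)$, and let $R_{\mu_E}(\gamma)=K_{\mu_E}(\gamma)-\gamma^{-1}$ for $\gamma\in H_{\mu_E}(A)$, extended by continuity to $0$ and to the finite endpoints of $H_{\mu_E}(A)$. Then the limits $H_{\min}=\lim_{z\uparrow\lambda_{\min}}H_{\mu_E}(z)$ and $H_{\max}=\lim_{z\downarrow\lambda_{\max}}H_{\mu_E}(z)$ exist in $[-\infty,+\infty]$, and for every $\theta\in\mathbb R$ $$\lim_{N\to\infty}\frac1N\log I_N^{(\beta)}(\theta,E_N)=\theta v(\theta)-\frac\beta2\int\log\Bigl(1+\frac2\beta\theta v(\theta)-\frac2\beta\theta\lambda\Bigr)d\mu_E(\lambda),$$ where $$v(\theta)=\begin{cases}R_{\mu_E}\bigl(\tfrac{2\theta}\beta\bigr)&\text{if }H_{\min}\le\tfrac{2\theta}\beta\le H_{\max},\\[2pt]\lambda_{\max}-\tfrac{\beta}{2\theta}&\text{if }\tfrac{2\theta}\beta>H_{\max},\\[2pt]\lambda_{\min}-\tfrac{\beta}{2\theta}&\text{if }\tfrac{2\theta}\beta<H_{\min}.\end{cases}$$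 Here the argument of the logarithm is positive for $\mu_E$-almost every $\lambda$, and the logarithm is $\mu_E$-integrable. -/

import Mathlib

open MeasureTheory Filter Topology Matrix

noncomputable section

namespace SphericalIntegral

/-! ### Haar probability measure on the orthogonal and unitary groups

`Matrix.unitaryGroup (Fin N) ℝ` is the orthogonal group and `Matrix.unitaryGroup (Fin N) ℂ` the
unitary group. -/

section Haar

variable (N : ℕ) (𝕜 : Type*) [RCLike 𝕜]

instance unitaryGroupMeasurableSpace : MeasurableSpace (unitaryGroup (Fin N) 𝕜) := borel _

instance unitaryGroupBorelSpace : BorelSpace (unitaryGroup (Fin N) 𝕜) := ⟨rfl⟩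

instance unitaryGroupIsTopologicalGroup : IsTopologicalGroup (unitaryGroup (Fin N) 𝕜) :=
  inferInstanceAs (IsTopologicalGroup (unitary (Matrix (Fin N) (Fin N) 𝕜)))

instance unitaryGroupCompactSpace : CompactSpace (unitaryGroup (Fin N) 𝕜) := by
  refine (isCompact_iff_compactSpace (s := (unitaryGroup (Fin N) 𝕜 : Set (Matrix (Fin N) (Fin N) 𝕜)))).mp ?_
  have hK : IsCompact (Set.univ.pi fun _ : Fin N => Set.univ.pi fun _ : Fin N =>
      Metric.closedBall (0 : 𝕜) 1) :=
    isCompact_univ_pi fun _ => isCompact_univ_pi fun _ => isCompact_closedBall _ _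
  refine hK.of_isClosed_subset (isClosed_unitary (R := Matrix (Fin N) (Fin N) 𝕜)) ?_
  intro U hU i _ j _
  simpa using entry_norm_bound_of_unitary hU i j

/-- The Haar probability measure on the group of `N × N` orthogonal (`𝕜 = ℝ`) or unitary (`𝕜 = ℂ`)
matrices: the Haar measure that gives mass one to the whole (compact) group. -/
def haarProb : Measure (unitaryGroup (Fin N) 𝕜) := Measure.haarMeasure ⊤

end Haar

/-! ### Spherical integrals -/

section Integral

variable {N : ℕ} {𝕜 : Type*} [RCLike 𝕜]

/-- The spherical integral `I_N(D, E) = ∫ exp (N tr (U D U* E)) dm(U)`. For Hermitian `D`, `E` the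
trace is a real number. -/
def sphericalIntegral (D E : Matrix (Fin N) (Fin N) 𝕜) : ℝ :=
  ∫ U : unitaryGroup (Fin N) 𝕜,
    Real.exp (N * RCLike.re (trace ((U : Matrix (Fin N) (Fin N) 𝕜) * D *
      (U : Matrix (Fin N) (Fin N) 𝕜)ᴴ * E))) ∂(haarProb N 𝕜)

/-- The matrix `diag (θ, 0, …, 0)`. -/
def rankOneDiag (N : ℕ) (𝕜 : Type*) [RCLike 𝕜] (θ : ℝ) : Matrix (Fin N) (Fin N) 𝕜 :=
  diagonal fun i => if (i : ℕ) = 0 then (θ : 𝕜) else 0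

/-- The rank one spherical integral `I_N(θ, E) = I_N(diag (θ, 0, …, 0), E)`. -/
def rankOneSphericalIntegral (θ : ℝ) (E : Matrix (Fin N) (Fin N) 𝕜) : ℝ :=
  sphericalIntegral (rankOneDiag N 𝕜 θ) E

/-- The spectral measure `(1/N) ∑ δ_{λ_i}` of a Hermitian matrix, as a finite measure (it is a
probability measure as soon as `N ≥ 1`). -/
def spectralMeasure {E : Matrix (Fin N) (Fin N) 𝕜} (hE : E.IsHermitian) : FiniteMeasure ℝ :=
  (N : NNReal)⁻¹ • ∑ i, (diracProba (hE.eigenvalues i)).toFiniteMeasure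

/-- The smallest eigenvalue (for `N ≥ 1`). -/
def minEigenvalue {E : Matrix (Fin N) (Fin N) 𝕜} (hE : E.IsHermitian) : ℝ :=
  ⨅ i, hE.eigenvalues i

/-- The largest eigenvalue (for `N ≥ 1`). -/
def maxEigenvalue {E : Matrix (Fin N) (Fin N) 𝕜} (hE : E.IsHermitian) : ℝ :=
  ⨆ i, hE.eigenvalues i

end Integral

/-! ### Hilbert transform and R-transform -/

/-- The Hilbert transform `H_μ(z) = ∫ (z - x)⁻¹ dμ(x)`, used only for `z` outside the support. -/
def hilbertTransform (μ : Measure ℝ) (z : ℝ) : ℝ := ∫ x, (z - x)⁻¹ ∂μ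

/-- The real points lying outside the smallest interval that contains the support of `μ`. -/
def outside (μ : Measure ℝ) : Set ℝ := (convexHull ℝ μ.support)ᶜ

/-- `K_μ`, the functional inverse of `H_μ : outside μ → H_μ (outside μ)`. -/
def inverseHilbert (μ : Measure ℝ) (γ : ℝ) : ℝ :=
  Function.invFunOn (hilbertTransform μ) (outside μ) γ

/-- The `R`-transform `R_μ(γ) = K_μ(γ) - γ⁻¹` on `H_μ (outside μ)`, extended by continuity to the
limit points of that set: to `0`, and to the endpoints of the set when these are finite. -/
def rTransform (μ : Measure ℝ) (γ : ℝ) : ℝ :=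
  extendFrom (hilbertTransform μ '' outside μ) (fun γ => inverseHilbert μ γ - γ⁻¹) γ

/-- The function `v(θ)`, in which `hMin` and `hMax` are the (possibly infinite) limits of `H_μ` at
`lMin` from the left and at `lMax` from the right. -/
def saddle (β : ℝ) (μ : Measure ℝ) (lMin lMax : ℝ) (hMin hMax : EReal) (θ : ℝ) : ℝ :=
  open Classical in
  if hMin ≤ ((2 * θ / β : ℝ) : EReal) ∧ ((2 * θ / β : ℝ) : EReal) ≤ hMax then
    rTransform μ (2 * θ / β)
  else if hMax < ((2 * θ / β : ℝ) : EReal) then lMax - β / (2 * θ)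
  else lMin - β / (2 * θ)

end SphericalIntegral

end

/-! Haar invariance turns the integral into the mean of exp(Nθ ∑ λᵢ|uᵢ|²) over a uniform unit vector
u. Put d = β and γ = 2θ/β; passing from (θ, E) to (-θ, -E) reduces to γ > 0. A Gaussian vector is
its norm times an independent uniform direction, so Gaussian integrals, which factor over
coordinates, control means over the sphere (`lintegral_eq_lintegral_haar`).

Upper bound (`log_expMean_le`). For κ above all eigenvalues let s = ∑ (κ - λᵢ)|uᵢ|². The exponent is
N(d/2)γ(κ - s), and log(γs) ≤ γs - 1 bounds exp(-N(d/2)γs) by a constant times s^(-Nd/2), whose Haar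
mean is exactly ∏ (κ - λᵢ)^(-d/2).

Lower bound (`eventually_le_log_expMean`). Give coordinate i the Gaussian weight γ(κ - λᵢ). With h
the limit of the mean of (κ - λᵢ)⁻¹, the squared norm concentrates at N(d/2)h/γ and ∑ (κ - λᵢ)|xᵢ|²
at N(d/2)/γ. When h < γ, the missing squared norm N(d/2)(1 - h/γ) is placed on one coordinate whose
eigenvalue is close to the maximum m. Up to o(1), this falls short of the upper bound by (d/2)(γ -
h)(κ - m) after taking (1/N) log.

If the Cauchy mean h equals γ at some κ > m, the bounds agree there. Otherwise, for h < γ on all of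
(m, ∞), letting κ decrease to m removes the loss (`IsSaddlePoint.exists_approx`). In both regimes v
= κ - 1/γ, so that 1 + γv - γλ = γ(κ - λ). In the first regime, and by continuity at the critical γ,
v is the R-transform; beyond it κ = m. -/

namespace SphericalIntegral

/-! ### Gaussian integrals over 𝕜^N and their unitary invariance -/

section GaussianIntegrals

variable {𝕜 : Type*} [RCLike 𝕜] {N : ℕ}

theorem lintegral_ofReal_prod {f : Fin N → 𝕜 → ℝ} (hf : ∀ i, Integrable (f i))
    (h0 : ∀ i x, 0 ≤ f i x) :
    ∫⁻ x : Fin N → 𝕜, ENNReal.ofReal (∏ i, f i (x i)) = ENNReal.ofReal (∏ i, ∫ x, f i x) := by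
  have h := integral_fintype_prod_eq_prod f (μ := fun _ : Fin N => (volume : Measure 𝕜))
  change ∫⁻ x, _ ∂(Measure.pi fun _ => volume) = _
  rw [← h, ofReal_integral_eq_lintegral_ofReal (Integrable.fintype_prod hf)]
  exact Eventually.of_forall fun x => Finset.prod_nonneg fun i _ => h0 i _

theorem integral_exp_neg_mul_normSq {b : ℝ} (hb : 0 < b) :
    ∫ x : 𝕜, Real.exp (-(b * ‖x‖ ^ 2)) = (Real.pi / b) ^ ((Module.finrank ℝ 𝕜 : ℝ) / 2) := by
  simpa using GaussianFourier.integral_rexp_neg_mul_sq_norm (V := 𝕜) hb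

theorem integrable_exp_neg_mul_normSq {b : ℝ} (hb : 0 < b) :
    Integrable fun x : 𝕜 => Real.exp (-(b * ‖x‖ ^ 2)) := by
  refine Integrable.of_integral_ne_zero ?_
  rw [integral_exp_neg_mul_normSq hb]
  have := Real.pi_pos
  positivity

theorem lintegral_gaussian {b : Fin N → ℝ} (hb : ∀ i, 0 < b i) :
    ∫⁻ x : Fin N → 𝕜, ENNReal.ofReal (Real.exp (-∑ i, b i * ‖x i‖ ^ 2)) =
      ENNReal.ofReal (∏ i, (Real.pi / b i) ^ ((Module.finrank ℝ 𝕜 : ℝ) / 2)) := by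
  simp_rw [← Finset.sum_neg_distrib, Real.exp_sum]
  rw [lintegral_ofReal_prod (f := fun i x => Real.exp (-(b i * ‖x‖ ^ 2)))
    (fun i => integrable_exp_neg_mul_normSq (hb i)) (fun i x => (Real.exp_pos _).le)]
  simp_rw [integral_exp_neg_mul_normSq (hb _)]

theorem sum_normSq_eq_norm_toLp (x : Fin N → 𝕜) :
    ∑ i, ‖x i‖ ^ 2 = ‖(WithLp.toLp 2 x : EuclideanSpace 𝕜 (Fin N))‖ ^ 2 := by
  rw [EuclideanSpace.norm_sq_eq]

theorem sum_normSq_eq_re_dotProduct (x : Fin N → 𝕜) :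
    ((∑ i, ‖x i‖ ^ 2 : ℝ) : 𝕜) = star x ⬝ᵥ x := by
  simp [dotProduct, RCLike.conj_mul]

theorem sum_normSq_unitary_mulVec (U : unitaryGroup (Fin N) 𝕜) (x : Fin N → 𝕜) :
    ∑ i, ‖((U : Matrix (Fin N) (Fin N) 𝕜) *ᵥ x) i‖ ^ 2 = ∑ i, ‖x i‖ ^ 2 := by
  have h : ((∑ i, ‖((U : Matrix (Fin N) (Fin N) 𝕜) *ᵥ x) i‖ ^ 2 : ℝ) : 𝕜) =
      ((∑ i, ‖x i‖ ^ 2 : ℝ) : 𝕜) := by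
    rw [sum_normSq_eq_re_dotProduct, sum_normSq_eq_re_dotProduct, star_mulVec,
      ← dotProduct_mulVec, mulVec_mulVec, ← star_eq_conjTranspose]
    simp
  exact_mod_cast h

/-- A linear bijection multiplies Lebesgue measure by a constant. The standard Gaussian weight is
invariant and has finite positive mass, so the constant is 1; no real determinant has to be
computed. -/
theorem map_unitary_mulVec_volume (U : unitaryGroup (Fin N) 𝕜) :
    Measure.map (fun x : Fin N → 𝕜 => (U : Matrix (Fin N) (Fin N) 𝕜) *ᵥ x) volume = volume := by
  set f : (Fin N → 𝕜) →ₗ[ℝ] (Fin N → 𝕜) :=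
    (Matrix.toLin' (U : Matrix (Fin N) (Fin N) 𝕜)).restrictScalars ℝ with hf
  have hfU : ∀ x, f x = (U : Matrix (Fin N) (Fin N) 𝕜) *ᵥ x := fun x => by simp [hf]
  have hdet : LinearMap.det f ≠ 0 := by
    have hinj : Function.Injective f := by
      intro x y hxy
      have := congrArg (fun z => (star (U : Matrix (Fin N) (Fin N) 𝕜)) *ᵥ z) hxy
      simpa [hfU, mulVec_mulVec] using this
    exact (LinearEquiv.isUnit_det' (LinearEquiv.ofInjectiveEndo f hinj)).ne_zero
  have hmap := Measure.map_linearMap_addHaar_eq_smul_addHaar (volume : Measure (Fin N → 𝕜)) hdet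
  have hcoe : (fun x : Fin N → 𝕜 => (U : Matrix (Fin N) (Fin N) 𝕜) *ᵥ x) = f := by
    ext1 x; exact (hfU x).symm
  rw [hcoe, hmap]
  set c := ENNReal.ofReal |(LinearMap.det f)⁻¹| with hc
  set G : (Fin N → 𝕜) → ENNReal :=
    fun x => ENNReal.ofReal (Real.exp (-∑ i, (1 : ℝ) * ‖x i‖ ^ 2)) with hG
  have hGm : Measurable G := by
    refine ENNReal.measurable_ofReal.comp (Continuous.measurable ?_)
    fun_prop
  have h1 : ∫⁻ x, G x ∂(Measure.map f volume) = ∫⁻ x, G x := by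
    rw [lintegral_map hGm (f.continuous_of_finiteDimensional.measurable)]
    refine lintegral_congr fun x => ?_
    simp only [hG, hfU, one_mul, sum_normSq_unitary_mulVec]
  have h2 : ∫⁻ x, G x = ENNReal.ofReal
      (∏ _i : Fin N, (Real.pi / 1) ^ ((Module.finrank ℝ 𝕜 : ℝ) / 2)) :=
    lintegral_gaussian fun _ => one_pos
  rw [hmap, lintegral_smul_measure, h2] at h1
  have h3 : c = 1 := by
    have hpos : 0 < ∏ _i : Fin N, (Real.pi / 1) ^ ((Module.finrank ℝ 𝕜 : ℝ) / 2) :=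
      Finset.prod_pos fun _ _ => Real.rpow_pos_of_pos (by simpa using Real.pi_pos) _
    rw [smul_eq_mul] at h1
    exact (ENNReal.mul_eq_right (ENNReal.ofReal_pos.2 hpos).ne' ENNReal.ofReal_ne_top).1 h1
  rw [h3, one_smul]

theorem lintegral_unitary_mulVec (U : unitaryGroup (Fin N) 𝕜) {G : (Fin N → 𝕜) → ENNReal}
    (hG : Measurable G) :
    ∫⁻ x, G ((U : Matrix (Fin N) (Fin N) 𝕜) *ᵥ x) = ∫⁻ x, G x := by
  conv_rhs => rw [← map_unitary_mulVec_volume U]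
  rw [lintegral_map hG]
  exact (continuous_const.matrix_mulVec continuous_id).measurable

end GaussianIntegrals

/-! ### Two-sided invariance of Haar measure and polar coordinates -/

section HaarInvariance

variable {𝕜 : Type*} [RCLike 𝕜] {N : ℕ}

instance isHaarMeasure_haarProb : (haarProb N 𝕜).IsHaarMeasure := by
  unfold haarProb; infer_instance

instance isProbabilityMeasure_haarProb : IsProbabilityMeasure (haarProb N 𝕜) :=
  ⟨Measure.haarMeasure_self
    (K₀ := (⊤ : TopologicalSpace.PositiveCompacts (unitaryGroup (Fin N) 𝕜)))⟩

/-- A right translate of the measure is again left invariant with mass one, and such a measure is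
unique on a compact group. -/
instance isMulRightInvariant_haarProb : (haarProb N 𝕜).IsMulRightInvariant := by
  refine ⟨fun g => ?_⟩
  have hp : IsProbabilityMeasure (Measure.map (fun x => x * g) (haarProb N 𝕜)) :=
    Measure.isProbabilityMeasure_map (measurable_mul_const g).aemeasurable
  have h := Measure.isMulInvariant_eq_smul_of_compactSpace
    (Measure.map (fun x => x * g) (haarProb N 𝕜)) (haarProb N 𝕜)
  have h1 := congrArg (fun m : Measure _ => m Set.univ) h
  simp only [Measure.smul_apply, measure_univ] at h1
  rw [h]
  have h2 : (Measure.map (fun x => x * g) (haarProb N 𝕜)).haarScalarFactor (haarProb N 𝕜) = 1 := by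
    rw [ENNReal.smul_def, smul_eq_mul, mul_one] at h1
    exact_mod_cast h1.symm
  rw [h2, one_smul]

theorem exists_unitary_mulVec_eq (i₀ : Fin N) (x : Fin N → 𝕜) (hx : ∑ i, ‖x i‖ ^ 2 = 1) :
    ∃ W : unitaryGroup (Fin N) 𝕜,
      (W : Matrix (Fin N) (Fin N) 𝕜) *ᵥ Pi.single i₀ 1 = x := by
  have hnorm : ‖(WithLp.toLp 2 x : EuclideanSpace 𝕜 (Fin N))‖ = 1 := by
    rw [sum_normSq_eq_norm_toLp] at hx
    exact (pow_eq_one_iff_of_nonneg (norm_nonneg _) two_ne_zero).1 hx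
  obtain ⟨b, hb⟩ := Orthonormal.exists_orthonormalBasis_extension_of_card_eq
    (𝕜 := 𝕜) (E := EuclideanSpace 𝕜 (Fin N)) (ι := Fin N) (by simp)
    (v := fun _ => WithLp.toLp 2 x) (s := {i₀}) (by
      constructor
      · intro i; simpa using hnorm
      · intro i j hij; exact absurd (Subsingleton.elim i j) hij)
  refine ⟨⟨_, (EuclideanSpace.basisFun (Fin N) 𝕜).toMatrix_orthonormalBasis_mem_unitary b⟩, ?_⟩
  ext i
  simp [Module.Basis.toMatrix_apply, hb i₀ rfl]

/-- Polar coordinates with Haar measure in place of surface measure. Averaging over rotations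
changes nothing; after exchanging the integrals, x = r W e for some unitary W, which right
invariance absorbs. -/
theorem lintegral_eq_lintegral_haar (i₀ : Fin N) {G : (Fin N → 𝕜) → ENNReal} (hG : Measurable G) :
    ∫⁻ x, G x = ∫⁻ x : Fin N → 𝕜, ∫⁻ U : unitaryGroup (Fin N) 𝕜,
      G (fun i => (√(∑ j, ‖x j‖ ^ 2) : 𝕜) * (U : Matrix (Fin N) (Fin N) 𝕜) i i₀)
        ∂(haarProb N 𝕜) := by
  have hcont : Continuous fun p : (unitaryGroup (Fin N) 𝕜) × (Fin N → 𝕜) =>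
      (p.1 : Matrix (Fin N) (Fin N) 𝕜) *ᵥ p.2 :=
    (continuous_subtype_val.comp continuous_fst).matrix_mulVec continuous_snd
  have key : ∫⁻ x, G x = ∫⁻ U : unitaryGroup (Fin N) 𝕜, (∫⁻ x : Fin N → 𝕜,
      G ((U : Matrix (Fin N) (Fin N) 𝕜) *ᵥ x)) ∂(haarProb N 𝕜) := by
    simp_rw [lintegral_unitary_mulVec _ hG]
    simp
  rw [key, lintegral_lintegral_swap
    (f := fun (U : unitaryGroup (Fin N) 𝕜) (x : Fin N → 𝕜) =>
      G ((U : Matrix (Fin N) (Fin N) 𝕜) *ᵥ x)) (hG.comp hcont.measurable).aemeasurable]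
  refine lintegral_congr fun x => ?_
  set r : ℝ := √(∑ j, ‖x j‖ ^ 2) with hr
  have hr2 : r ^ 2 = ∑ j, ‖x j‖ ^ 2 := Real.sq_sqrt (by positivity)
  by_cases hr0 : r = 0
  · have hx : x = 0 := by
      rw [hr0] at hr2
      have := (Finset.sum_eq_zero_iff_of_nonneg fun i _ => by positivity).1
        (hr2.symm.trans (by norm_num))
      ext i
      simpa using this i (Finset.mem_univ i)
    simp [hx, hr0]
    rfl
  · obtain ⟨W, hW⟩ := exists_unitary_mulVec_eq i₀ (fun i => ((r⁻¹ : ℝ) : 𝕜) * x i) (by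
      simp only [norm_mul, mul_pow, RCLike.norm_ofReal, sq_abs]
      rw [← Finset.mul_sum, ← hr2, ← mul_pow, inv_mul_cancel₀ hr0, one_pow])
    have hx : x = (r : 𝕜) • ((W : Matrix (Fin N) (Fin N) 𝕜) *ᵥ Pi.single i₀ 1) := by
      have : (r : 𝕜) ≠ 0 := by exact_mod_cast hr0
      ext i
      rw [hW]
      simp [this]
    conv_lhs => rw [hx]
    rw [← lintegral_mul_right_eq_self (μ := haarProb N 𝕜)
      (fun U : unitaryGroup (Fin N) 𝕜 => G (fun i => (r : 𝕜) *
        (U : Matrix (Fin N) (Fin N) 𝕜) i i₀)) W]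
    refine lintegral_congr fun U => congrArg G ?_
    ext i
    rw [mulVec_smul, mulVec_mulVec]
    simp

end HaarInvariance

/-! ### Reduction to one Haar column, the upper bound and the cone inequality -/

section ExpMean

variable {N : ℕ}

/-- The mean of `exp (N θ ∑ lᵢ |uᵢ|²)` over a Haar distributed unit vector `u`, realised as the
column `i₀` of a Haar distributed matrix. -/
noncomputable def expMean (𝕜 : Type*) [RCLike 𝕜] (l : Fin N → ℝ) (θ : ℝ) (i₀ : Fin N) : ℝ :=
  ∫ U : unitaryGroup (Fin N) 𝕜,
    Real.exp (N * (θ * ∑ i, l i * ‖(U : Matrix (Fin N) (Fin N) 𝕜) i i₀‖ ^ 2)) ∂(haarProb N 𝕜)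

variable {𝕜 : Type*} [RCLike 𝕜]

theorem continuous_normSq_entry (i j : Fin N) :
    Continuous fun U : unitaryGroup (Fin N) 𝕜 => ‖(U : Matrix (Fin N) (Fin N) 𝕜) i j‖ ^ 2 :=
  ((continuous_subtype_val.matrix_elem i j).norm).pow 2

theorem sum_normSq_col (U : unitaryGroup (Fin N) 𝕜) (j : Fin N) :
    ∑ i, ‖(U : Matrix (Fin N) (Fin N) 𝕜) i j‖ ^ 2 = 1 := by
  have h := sum_normSq_unitary_mulVec U (Pi.single j 1)
  simp only [mulVec_single_one, col_apply] at h
  rw [h, Finset.sum_eq_single j]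
  · simp
  · intro i _ hi; simp [hi]
  · simp

theorem sum_mul_normSq_col_pos {c : Fin N → ℝ} (hc : ∀ i, 0 < c i)
    (U : unitaryGroup (Fin N) 𝕜) (i₀ : Fin N) :
    0 < ∑ i, c i * ‖(U : Matrix (Fin N) (Fin N) 𝕜) i i₀‖ ^ 2 := by
  have h1 := sum_normSq_col U i₀
  obtain ⟨i, -, hi⟩ : ∃ i ∈ Finset.univ, 0 < ‖(U : Matrix (Fin N) (Fin N) 𝕜) i i₀‖ ^ 2 := by
    by_contra! h
    have := Finset.sum_nonpos h
    linarith
  exact Finset.sum_pos' (fun i _ => mul_nonneg (hc i).le (by positivity))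
    ⟨i, Finset.mem_univ i, mul_pos (hc i) hi⟩

/-- Left invariance absorbs the eigenvector matrix of E, and the rank one diagonal matrix retains a
single column of U. -/
theorem rankOneSphericalIntegral_eq_expMean (θ : ℝ) {E : Matrix (Fin N) (Fin N) 𝕜}
    (hE : E.IsHermitian) (i₀ : Fin N) (hi₀ : (i₀ : ℕ) = 0) :
    rankOneSphericalIntegral θ E = expMean 𝕜 hE.eigenvalues θ i₀ := by
  unfold rankOneSphericalIntegral sphericalIntegral expMean
  rw [← integral_mul_left_eq_self _ hE.eigenvectorUnitary]
  refine integral_congr_ae (Eventually.of_forall fun U => ?_)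
  dsimp only
  congr 2
  set V := (hE.eigenvectorUnitary : Matrix (Fin N) (Fin N) 𝕜) with hV
  set Λ : Matrix (Fin N) (Fin N) 𝕜 := diagonal (RCLike.ofReal ∘ hE.eigenvalues)
  have hVV : Vᴴ * V = 1 := by
    rw [← star_eq_conjTranspose]; exact Unitary.coe_star_mul_self _
  have hE' : E = V * Λ * Vᴴ := by
    conv_lhs => rw [hE.spectral_theorem, Unitary.conjStarAlgAut_apply]
    rfl
  have htr : ∀ F, F = V * Λ * Vᴴ → trace (((hE.eigenvectorUnitary * U : unitaryGroup (Fin N) 𝕜) :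
      Matrix (Fin N) (Fin N) 𝕜) * rankOneDiag N 𝕜 θ *
      ((hE.eigenvectorUnitary * U : unitaryGroup (Fin N) 𝕜) : Matrix (Fin N) (Fin N) 𝕜)ᴴ * F) =
      trace ((U : Matrix (Fin N) (Fin N) 𝕜) * rankOneDiag N 𝕜 θ *
        (U : Matrix (Fin N) (Fin N) 𝕜)ᴴ * Λ) := by
    rintro F rfl
    rw [Submonoid.coe_mul, ← hV, conjTranspose_mul]
    calc _ = trace (V * ((U : Matrix (Fin N) (Fin N) 𝕜) * rankOneDiag N 𝕜 θ *
          (U : Matrix (Fin N) (Fin N) 𝕜)ᴴ * (Vᴴ * V) * Λ * Vᴴ)) := by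
          simp only [Matrix.mul_assoc]
      _ = trace (((U : Matrix (Fin N) (Fin N) 𝕜) * rankOneDiag N 𝕜 θ *
          (U : Matrix (Fin N) (Fin N) 𝕜)ᴴ * (Vᴴ * V) * Λ) * (Vᴴ * V)) := by
          rw [trace_mul_comm]; simp only [Matrix.mul_assoc]
      _ = _ := by rw [hVV, Matrix.mul_one, Matrix.mul_one]
  rw [htr E hE']
  simp only [trace, diag_apply, Λ, mul_diagonal, Function.comp, map_sum, RCLike.re_mul_ofReal]
  rw [Finset.mul_sum]
  refine Finset.sum_congr rfl fun i _ => ?_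
  rw [mul_apply, Finset.sum_eq_single i₀]
  · simp only [rankOneDiag, mul_diagonal, hi₀, if_true, conjTranspose_apply]
    rw [mul_right_comm, RCLike.star_def, RCLike.mul_conj]
    rw [← RCLike.ofReal_pow, ← RCLike.ofReal_mul, RCLike.ofReal_re]
    ring
  · intro j _ hj
    have : (j : ℕ) ≠ 0 := fun h => hj (Fin.ext (h.trans hi₀.symm))
    simp [rankOneDiag, mul_diagonal, this]
  · simp

theorem continuous_expMean_integrand (l : Fin N → ℝ) (θ : ℝ) (i₀ : Fin N) :
    Continuous fun U : unitaryGroup (Fin N) 𝕜 =>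
      Real.exp (N * (θ * ∑ i, l i * ‖(U : Matrix (Fin N) (Fin N) 𝕜) i i₀‖ ^ 2)) := by
  refine Real.continuous_exp.comp (continuous_const.mul (continuous_const.mul ?_))
  exact continuous_finsetSum _ fun i _ => continuous_const.mul (continuous_normSq_entry i i₀)

theorem integrable_expMean_integrand (l : Fin N → ℝ) (θ : ℝ) (i₀ : Fin N) :
    Integrable (fun U : unitaryGroup (Fin N) 𝕜 =>
      Real.exp (N * (θ * ∑ i, l i * ‖(U : Matrix (Fin N) (Fin N) 𝕜) i i₀‖ ^ 2)))
      (haarProb N 𝕜) :=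
  (continuous_expMean_integrand l θ i₀).integrable_of_hasCompactSupport
    (HasCompactSupport.of_compactSpace _)

theorem ofReal_expMean (l : Fin N → ℝ) (θ : ℝ) (i₀ : Fin N) :
    ENNReal.ofReal (expMean 𝕜 l θ i₀) = ∫⁻ U : unitaryGroup (Fin N) 𝕜, ENNReal.ofReal
      (Real.exp (N * (θ * ∑ i, l i * ‖(U : Matrix (Fin N) (Fin N) 𝕜) i i₀‖ ^ 2)))
      ∂(haarProb N 𝕜) :=
  ofReal_integral_eq_lintegral_ofReal (integrable_expMean_integrand l θ i₀)
    (Eventually.of_forall fun _ => (Real.exp_pos _).le)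

theorem expMean_pos (l : Fin N → ℝ) (θ : ℝ) (i₀ : Fin N) : 0 < expMean 𝕜 l θ i₀ :=
  integral_exp_pos (integrable_expMean_integrand l θ i₀)

theorem expMean_neg (l : Fin N → ℝ) (θ : ℝ) (i₀ : Fin N) :
    expMean 𝕜 (fun i => -l i) (-θ) i₀ = expMean 𝕜 l θ i₀ := by
  simp [expMean]

theorem expMean_zero (l : Fin N → ℝ) (i₀ : Fin N) : expMean 𝕜 l 0 i₀ = 1 := by
  simp [expMean]

/-- The Gaussian integral with weights c in polar coordinates: for a fixed direction U it is an
isotropic Gaussian integral whose weight is the quadratic form evaluated at that direction. -/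
theorem lintegral_haar_rpow {c : Fin N → ℝ} (hc : ∀ i, 0 < c i) (i₀ : Fin N) :
    ∫⁻ U : unitaryGroup (Fin N) 𝕜, ENNReal.ofReal (∏ _j : Fin N, (Real.pi /
      ∑ i, c i * ‖(U : Matrix (Fin N) (Fin N) 𝕜) i i₀‖ ^ 2) ^ ((Module.finrank ℝ 𝕜 : ℝ) / 2))
        ∂(haarProb N 𝕜) =
      ENNReal.ofReal (∏ i, (Real.pi / c i) ^ ((Module.finrank ℝ 𝕜 : ℝ) / 2)) := by
  have hm : Measurable fun x : Fin N → 𝕜 =>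
      ENNReal.ofReal (Real.exp (-∑ i, c i * ‖x i‖ ^ 2)) :=
    ENNReal.measurable_ofReal.comp (Continuous.measurable (by fun_prop))
  rw [← lintegral_gaussian hc, lintegral_eq_lintegral_haar i₀ hm, lintegral_lintegral_swap]
  · refine lintegral_congr fun U => ?_
    have hpos : 0 < ∑ i, c i * ‖(U : Matrix (Fin N) (Fin N) 𝕜) i i₀‖ ^ 2 :=
      sum_mul_normSq_col_pos hc U i₀
    rw [← lintegral_gaussian (𝕜 := 𝕜) fun _ => hpos]
    refine lintegral_congr fun x => ?_
    congr 3
    simp only [norm_mul, mul_pow, RCLike.norm_ofReal, sq_abs]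
    rw [← Finset.mul_sum, Real.sq_sqrt (by positivity), Finset.sum_mul]
    exact Finset.sum_congr rfl fun i _ => by ring
  · refine (ENNReal.measurable_ofReal.comp (Continuous.measurable ?_)).aemeasurable
    refine Real.continuous_exp.comp (Continuous.neg ?_)
    refine continuous_finsetSum _ fun i _ => continuous_const.mul (Continuous.pow ?_ 2)
    refine (Continuous.mul ?_ ?_).norm
    · fun_prop
    · exact (continuous_subtype_val.comp continuous_snd).matrix_elem i i₀

theorem finrank_real_pos (𝕜 : Type*) [RCLike 𝕜] : (0 : ℝ) < Module.finrank ℝ 𝕜 := by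
  exact_mod_cast Module.finrank_pos

/-- The tangent bound log(γs) ≤ γs - 1 is an equality at s = 1/γ, so little is lost where s
concentrates there. It trades the exponential for a power of s whose Haar mean is explicit. The
bound holds for every N. -/
theorem log_expMean_le {l : Fin N → ℝ} {κ γ : ℝ} (hκ : ∀ i, l i < κ) (hγ : 0 < γ) (i₀ : Fin N) :
    Real.log (expMean 𝕜 l (Module.finrank ℝ 𝕜 / 2 * γ) i₀) ≤
      Module.finrank ℝ 𝕜 / 2 * (N * (γ * κ - 1 - Real.log γ) - ∑ i, Real.log (κ - l i)) := by
  set d := (Module.finrank ℝ 𝕜 : ℝ) with hd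
  have hd0 : 0 < d := finrank_real_pos 𝕜
  have hc : ∀ i, 0 < κ - l i := fun i => sub_pos.2 (hκ i)
  have hpi := Real.pi_pos
  rw [Real.log_le_iff_le_exp (expMean_pos l _ i₀)]
  set C : ℝ := Real.exp (d / 2 * (γ * κ - 1 - Real.log γ - Real.log Real.pi)) with hC
  have hbound : ∀ U : unitaryGroup (Fin N) 𝕜, Real.exp (N * (d / 2 * γ * ∑ i, l i *
      ‖(U : Matrix (Fin N) (Fin N) 𝕜) i i₀‖ ^ 2)) ≤ C ^ N * ∏ _j : Fin N, (Real.pi /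
      ∑ i, (κ - l i) * ‖(U : Matrix (Fin N) (Fin N) 𝕜) i i₀‖ ^ 2) ^ (d / 2) := by
    intro U
    set s := ∑ i, (κ - l i) * ‖(U : Matrix (Fin N) (Fin N) 𝕜) i i₀‖ ^ 2 with hs
    have hq : ∑ i, l i * ‖(U : Matrix (Fin N) (Fin N) 𝕜) i i₀‖ ^ 2 = κ - s := by
      have h1 := sum_normSq_col U i₀
      simp only [hs, sub_mul, Finset.sum_sub_distrib, ← Finset.mul_sum, h1]
      ring
    have hpos : 0 < s :=
      sum_mul_normSq_col_pos hc U i₀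
    rw [hq, Finset.prod_const, Finset.card_univ, Fintype.card_fin, ← mul_pow, Real.exp_nat_mul]
    refine pow_le_pow_left₀ (Real.exp_pos _).le ?_ N
    rw [Real.rpow_def_of_pos (by positivity), hC, ← Real.exp_add, Real.exp_le_exp,
      Real.log_div hpi.ne' hpos.ne']
    have h2 := Real.log_le_sub_one_of_pos (mul_pos hγ hpos)
    rw [Real.log_mul hγ.ne' hpos.ne'] at h2
    nlinarith
  have hle : ENNReal.ofReal (expMean 𝕜 l (d / 2 * γ) i₀) ≤
      ENNReal.ofReal (C ^ N * ∏ i, (Real.pi / (κ - l i)) ^ (d / 2)) := by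
    rw [ofReal_expMean, ENNReal.ofReal_mul (by positivity), ← lintegral_haar_rpow hc i₀,
      ← lintegral_const_mul' _ _ ENNReal.ofReal_ne_top]
    refine lintegral_mono fun U => ?_
    rw [← ENNReal.ofReal_mul (by positivity)]
    exact ENNReal.ofReal_le_ofReal (hbound U)
  have hfin : C ^ N * ∏ i, (Real.pi / (κ - l i)) ^ (d / 2) =
      Real.exp (d / 2 * (N * (γ * κ - 1 - Real.log γ) - ∑ i, Real.log (κ - l i))) := by
    have : ∀ i, (Real.pi / (κ - l i)) ^ (d / 2) =
        Real.exp ((Real.log Real.pi - Real.log (κ - l i)) * (d / 2)) := fun i => by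
      rw [Real.rpow_def_of_pos (div_pos hpi (hc i)), Real.log_div hpi.ne' (hc i).ne']
    simp_rw [this]
    rw [← Real.exp_sum, hC, ← Real.exp_nat_mul, ← Real.exp_add, ← Finset.sum_mul,
      Finset.sum_sub_distrib]
    simp
    ring
  rw [← hfin]
  exact (ENNReal.ofReal_le_ofReal_iff (by
    exact mul_nonneg (by positivity) (Finset.prod_nonneg fun i _ =>
      Real.rpow_nonneg (div_pos hpi (hc i)).le _))).1 hle

/-- Both sides of `hw` are homogeneous of degree two. In polar coordinates the radius cancels, so
exp w is at most the integrand at every direction U for which the point of norm ‖x‖ lies in S. -/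
theorem exp_mul_setLIntegral_le_expMean (l : Fin N → ℝ) (θ w : ℝ) (i₀ : Fin N)
    {S : Set (Fin N → 𝕜)} (hS : MeasurableSet S) (h0 : ∀ x ∈ S, 0 < ∑ i, ‖x i‖ ^ 2)
    (hw : ∀ x ∈ S, w * ∑ i, ‖x i‖ ^ 2 ≤ N * (θ * ∑ i, l i * ‖x i‖ ^ 2)) :
    ENNReal.ofReal (Real.exp w) * ∫⁻ x in S, ENNReal.ofReal (Real.exp (-∑ i, ‖x i‖ ^ 2)) ≤
      ENNReal.ofReal (expMean 𝕜 l θ i₀) *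
        ENNReal.ofReal (Real.pi ^ ((Module.finrank ℝ 𝕜 : ℝ) / 2 * N)) := by
  set g : (Fin N → 𝕜) → ENNReal := fun x => ENNReal.ofReal (Real.exp (-∑ i, ‖x i‖ ^ 2)) with hg
  have hgm : Measurable g :=
    ENNReal.measurable_ofReal.comp (Continuous.measurable (by fun_prop))
  have hgauss : ∫⁻ x, g x =
      ENNReal.ofReal (Real.pi ^ ((Module.finrank ℝ 𝕜 : ℝ) / 2 * N)) := by
    have := lintegral_gaussian (𝕜 := 𝕜) (b := fun _ : Fin N => (1 : ℝ)) fun _ => one_pos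
    simpa [hg, Real.rpow_mul_natCast Real.pi_pos.le] using this
  rw [← lintegral_indicator hS, lintegral_eq_lintegral_haar i₀ (hgm.indicator hS), ← hgauss,
    ofReal_expMean, ← lintegral_const_mul' _ _ ENNReal.ofReal_ne_top,
    ← lintegral_const_mul _ hgm]
  refine lintegral_mono fun x => ?_
  rw [← lintegral_const_mul' _ _ ENNReal.ofReal_ne_top, ← lintegral_mul_const' _ _
    ENNReal.ofReal_ne_top]
  refine lintegral_mono fun U => ?_
  by_cases hx : (fun i => (√(∑ j, ‖x j‖ ^ 2) : 𝕜) * (U : Matrix (Fin N) (Fin N) 𝕜) i i₀) ∈ S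
  · have hsq : ∀ c : Fin N → ℝ, ∑ i, c i * ‖(√(∑ j, ‖x j‖ ^ 2) : 𝕜) *
        (U : Matrix (Fin N) (Fin N) 𝕜) i i₀‖ ^ 2 =
        (∑ j, ‖x j‖ ^ 2) * ∑ i, c i * ‖(U : Matrix (Fin N) (Fin N) 𝕜) i i₀‖ ^ 2 := by
      intro c
      simp only [norm_mul, mul_pow, RCLike.norm_ofReal, sq_abs]
      rw [Real.sq_sqrt (by positivity), Finset.mul_sum]
      exact Finset.sum_congr rfl fun i _ => by ring
    have hsq1 := hsq fun _ => 1
    simp only [one_mul, sum_normSq_col, mul_one] at hsq1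
    have h1 := h0 _ hx
    have h2 := hw _ hx
    rw [hsq1] at h1
    simp only [hsq, hsq1] at h2
    rw [Set.indicator_of_mem hx]
    simp only [hg, hsq1]
    refine mul_le_mul' (ENNReal.ofReal_le_ofReal (Real.exp_le_exp.2 ?_)) le_rfl
    refine le_of_mul_le_mul_right (h2.trans_eq ?_) h1
    ring
  · rw [Set.indicator_of_notMem hx]
    simp

end ExpMean

/-! ### Tilted Gaussian densities and exponential tail bounds -/

section Tilting

variable {𝕜 : Type*} [RCLike 𝕜] {N : ℕ}

/-- The indicator of `x i₀ ∈ D` times a product of Gaussian densities in the other coordinates. -/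
noncomputable def tiltedDensity (i₀ : Fin N) (D : Set 𝕜) (b : Fin N → ℝ) (x : Fin N → 𝕜) : ℝ :=
  D.indicator 1 (x i₀) * Real.exp (-∑ i ∈ Finset.univ.erase i₀, b i * ‖x i‖ ^ 2)

theorem tiltedDensity_of_notMem {i₀ : Fin N} {D : Set 𝕜} (b : Fin N → ℝ) {x : Fin N → 𝕜}
    (hx : x i₀ ∉ D) : tiltedDensity i₀ D b x = 0 := by
  simp [tiltedDensity, hx]

theorem lintegral_tiltedDensity (i₀ : Fin N) {D : Set 𝕜} (hD : MeasurableSet D)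
    (hDfin : volume D ≠ ⊤) {b : Fin N → ℝ} (hb : ∀ i, 0 < b i) :
    ∫⁻ x, ENNReal.ofReal (tiltedDensity i₀ D b x) = ENNReal.ofReal (volume.real D *
      ∏ i ∈ Finset.univ.erase i₀, (Real.pi / b i) ^ ((Module.finrank ℝ 𝕜 : ℝ) / 2)) := by
  set f : Fin N → 𝕜 → ℝ := fun i =>
    if i = i₀ then D.indicator 1 else fun y => Real.exp (-(b i * ‖y‖ ^ 2)) with hf
  have hfi : ∀ i ∈ Finset.univ.erase i₀, f i = fun y => Real.exp (-(b i * ‖y‖ ^ 2)) := by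
    intro i hi
    simp [hf, Finset.ne_of_mem_erase hi]
  have hf0 : f i₀ = D.indicator 1 := by simp [hf]
  have hprod : ∀ x : Fin N → 𝕜, tiltedDensity i₀ D b x = ∏ i, f i (x i) := by
    intro x
    rw [← Finset.mul_prod_erase _ _ (Finset.mem_univ i₀), hf0, tiltedDensity,
      ← Finset.sum_neg_distrib, Real.exp_sum]
    congr 1
    exact Finset.prod_congr rfl fun i hi => by rw [hfi i hi]
  simp_rw [hprod]
  rw [lintegral_ofReal_prod]
  · rw [← Finset.mul_prod_erase _ _ (Finset.mem_univ i₀), hf0, integral_indicator_one hD]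
    congr 2
    exact Finset.prod_congr rfl fun i hi => by rw [hfi i hi, integral_exp_neg_mul_normSq (hb i)]
  · intro i
    by_cases hi : i = i₀
    · subst hi
      rw [hf0]
      exact (integrable_indicator_iff hD).2 (integrableOn_const hDfin)
    · rw [hfi i (by simp [hi])]
      exact integrable_exp_neg_mul_normSq (hb i)
  · intro i x
    by_cases hi : i = i₀
    · subst hi
      rw [hf0]
      exact Set.indicator_nonneg (fun _ _ => zero_le_one) _
    · rw [hfi i (by simp [hi])]
      exact (Real.exp_pos _).le

theorem neg_log_one_sub_le {z : ℝ} (hz : |z| ≤ 1 / 2) : -Real.log (1 - z) ≤ z + 2 * z ^ 2 := by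
  have hpos : 0 < 1 - z := by linarith [(abs_le.1 hz).2]
  have h := Real.log_le_sub_one_of_pos (inv_pos.2 hpos)
  rw [Real.log_inv] at h
  have h2 : (1 - z)⁻¹ ≤ 1 + z + 2 * z ^ 2 := by
    rw [inv_le_iff_one_le_mul₀ hpos]
    nlinarith [sq_nonneg z, (abs_le.1 hz).2]
  linarith

/-- Chernoff's bound: on the set, 1 ≤ exp(-m + ∑ cᵢ|xᵢ|²), which changes the weights a into a - c.
The resulting ratio of normalisations is expanded to second order in c/a. -/
theorem setLIntegral_tiltedDensity_le (i₀ : Fin N) {D : Set 𝕜} (hD : MeasurableSet D)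
    (hDfin : volume D ≠ ⊤) {a : Fin N → ℝ} (ha : ∀ i, 0 < a i) (c : Fin N → ℝ) (m : ℝ)
    (hc : ∀ i, |c i / a i| ≤ 1 / 2) :
    ∫⁻ x in {x : Fin N → 𝕜 | m ≤ ∑ i ∈ Finset.univ.erase i₀, c i * ‖x i‖ ^ 2},
        ENNReal.ofReal (tiltedDensity i₀ D a x) ≤
      ENNReal.ofReal (Real.exp (-m + (Module.finrank ℝ 𝕜 : ℝ) / 2 *
        ∑ i ∈ Finset.univ.erase i₀, (c i / a i + 2 * (c i / a i) ^ 2))) *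
        ∫⁻ x, ENNReal.ofReal (tiltedDensity i₀ D a x) := by
  set d := (Module.finrank ℝ 𝕜 : ℝ) with hd
  have hd0 : 0 < d := finrank_real_pos 𝕜
  have hac : ∀ i, 0 < a i - c i := by
    intro i
    have h := (abs_le.1 (hc i)).2
    rw [div_le_iff₀ (ha i)] at h
    linarith [ha i]
  have h1 : ∫⁻ x in {x : Fin N → 𝕜 | m ≤ ∑ i ∈ Finset.univ.erase i₀, c i * ‖x i‖ ^ 2},
        ENNReal.ofReal (tiltedDensity i₀ D a x) ≤
      ∫⁻ x, ENNReal.ofReal (Real.exp (-m)) *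
        ENNReal.ofReal (tiltedDensity i₀ D (fun i => a i - c i) x) := by
    refine (setLIntegral_mono' (measurableSet_le measurable_const
      (Continuous.measurable (by fun_prop))) fun x hx => ?_).trans (setLIntegral_le_lintegral _ _)
    rw [← ENNReal.ofReal_mul (Real.exp_pos _).le]
    refine ENNReal.ofReal_le_ofReal ?_
    unfold tiltedDensity
    rw [mul_left_comm, ← Real.exp_add]
    refine mul_le_mul_of_nonneg_left (Real.exp_le_exp.2 ?_)
      (Set.indicator_nonneg (fun _ _ => zero_le_one) _)
    simp only [sub_mul, Finset.sum_sub_distrib]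
    have : m ≤ ∑ i ∈ Finset.univ.erase i₀, c i * ‖x i‖ ^ 2 := hx
    linarith
  refine h1.trans ?_
  rw [lintegral_const_mul' _ _ ENNReal.ofReal_ne_top, lintegral_tiltedDensity i₀ hD hDfin hac,
    lintegral_tiltedDensity i₀ hD hDfin ha, ← ENNReal.ofReal_mul (Real.exp_pos _).le,
    ← ENNReal.ofReal_mul (Real.exp_pos _).le]
  refine ENNReal.ofReal_le_ofReal ?_
  rw [Real.exp_add, Finset.mul_sum, Real.exp_sum, mul_assoc]
  refine mul_le_mul_of_nonneg_left ?_ (Real.exp_pos _).le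
  rw [mul_left_comm, ← Finset.prod_mul_distrib]
  refine mul_le_mul_of_nonneg_left ?_ measureReal_nonneg
  refine Finset.prod_le_prod (fun i _ => Real.rpow_nonneg (div_pos Real.pi_pos (hac i)).le _)
    fun i _ => ?_
  rw [Real.rpow_def_of_pos (div_pos Real.pi_pos (hac i)),
    Real.rpow_def_of_pos (div_pos Real.pi_pos (ha i)), ← Real.exp_add, Real.exp_le_exp,
    Real.log_div Real.pi_pos.ne' (hac i).ne', Real.log_div Real.pi_pos.ne' (ha i).ne']
  have h2 := neg_log_one_sub_le (hc i)
  have h3 : 1 - c i / a i = (a i - c i) / a i := by field_simp [(ha i).ne']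
  rw [h3, Real.log_div (hac i).ne' (ha i).ne'] at h2
  nlinarith

end Tilting

/-! ### Lower bound for fixed N, given concentration -/

section LowerBound

variable {𝕜 : Type*} [RCLike 𝕜] {N : ℕ}

/-- The density vanishes off D, and the four tails carry at most 4 · 1/8 = 1/2 of its mass. -/
theorem half_lintegral_tiltedDensity_le (i₀ : Fin N) {D : Set 𝕜} (hD : MeasurableSet D)
    (hDfin : volume D ≠ ⊤) {a : Fin N → ℝ} (ha : ∀ i, 0 < a i)
    (f g : (Fin N → 𝕜) → ℝ) (hf : Measurable f) (hg : Measurable g) (p q t : ℝ)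
    (h₁ : ∫⁻ x in {x | p + t ≤ f x}, ENNReal.ofReal (tiltedDensity i₀ D a x) ≤
      ENNReal.ofReal (1 / 8) * ∫⁻ x, ENNReal.ofReal (tiltedDensity i₀ D a x))
    (h₂ : ∫⁻ x in {x | -p + t ≤ -f x}, ENNReal.ofReal (tiltedDensity i₀ D a x) ≤
      ENNReal.ofReal (1 / 8) * ∫⁻ x, ENNReal.ofReal (tiltedDensity i₀ D a x))
    (h₃ : ∫⁻ x in {x | q + t ≤ g x}, ENNReal.ofReal (tiltedDensity i₀ D a x) ≤
      ENNReal.ofReal (1 / 8) * ∫⁻ x, ENNReal.ofReal (tiltedDensity i₀ D a x))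
    (h₄ : ∫⁻ x in {x | -q + t ≤ -g x}, ENNReal.ofReal (tiltedDensity i₀ D a x) ≤
      ENNReal.ofReal (1 / 8) * ∫⁻ x, ENNReal.ofReal (tiltedDensity i₀ D a x)) :
    ENNReal.ofReal (1 / 2) * ∫⁻ x, ENNReal.ofReal (tiltedDensity i₀ D a x) ≤
      ∫⁻ x in {x | x i₀ ∈ D ∧ |f x - p| ≤ t ∧ |g x - q| ≤ t},
        ENNReal.ofReal (tiltedDensity i₀ D a x) := by
  have hfin : ∫⁻ x, ENNReal.ofReal (tiltedDensity i₀ D a x) ≠ ⊤ := by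
    rw [lintegral_tiltedDensity i₀ hD hDfin ha]; exact ENNReal.ofReal_ne_top
  set Z := ∫⁻ x, ENNReal.ofReal (tiltedDensity i₀ D a x) with hZ
  set w : (Fin N → 𝕜) → ENNReal := fun x => ENNReal.ofReal (tiltedDensity i₀ D a x) with hw
  set S := {x : Fin N → 𝕜 | x i₀ ∈ D ∧ |f x - p| ≤ t ∧ |g x - q| ≤ t} with hS
  have hcover : Z ≤ ∫⁻ x in S ∪ ({x | p + t ≤ f x} ∪ ({x | -p + t ≤ -f x} ∪
      ({x | q + t ≤ g x} ∪ {x | -q + t ≤ -g x}))), w x := by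
    rw [hZ, ← lintegral_indicator]
    · refine lintegral_mono fun x => ?_
      by_cases hx : x i₀ ∈ D
      · rw [Set.indicator_of_mem]
        simp only [hS, Set.mem_union, Set.mem_ofPred_eq, hx, true_and]
        by_contra! hcon
        obtain ⟨h0, h1, h2, h3, h4⟩ := hcon
        have := h0 (abs_le.2 ⟨by linarith, by linarith⟩)
        exact absurd (abs_le.2 ⟨by linarith, by linarith⟩) (not_le.2 this)
      · simp [hw, tiltedDensity_of_notMem a hx]
    · exact MeasurableSet.union ((measurable_pi_apply i₀ hD).inter
        ((measurableSet_le (continuous_abs.measurable.comp (hf.sub_const p)) measurable_const).inter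
        (measurableSet_le (continuous_abs.measurable.comp (hg.sub_const q)) measurable_const)))
        ((measurableSet_le measurable_const hf).union
        ((measurableSet_le measurable_const hf.neg).union
        ((measurableSet_le measurable_const hg).union (measurableSet_le measurable_const hg.neg))))
  have hsum : Z ≤ (∫⁻ x in S, w x) + ENNReal.ofReal (1 / 2) * Z := by
    refine hcover.trans ((lintegral_union_le _ _ _).trans (add_le_add le_rfl ?_))
    refine (lintegral_union_le _ _ _).trans ((add_le_add h₁
      ((lintegral_union_le _ _ _).trans (add_le_add h₂
        ((lintegral_union_le _ _ _).trans (add_le_add h₃ h₄))))).trans_eq ?_)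
    rw [← add_mul, ← add_mul, ← add_mul, ← ENNReal.ofReal_add (by norm_num) (by norm_num),
      ← ENNReal.ofReal_add (by norm_num) (by norm_num),
      ← ENNReal.ofReal_add (by norm_num) (by norm_num)]
    norm_num
  have hhalf : Z = ENNReal.ofReal (1 / 2) * Z + ENNReal.ofReal (1 / 2) * Z := by
    rw [← add_mul, ← ENNReal.ofReal_add (by norm_num) (by norm_num)]
    norm_num
  exact (ENNReal.add_le_add_iff_right (ENNReal.mul_ne_top ENNReal.ofReal_ne_top hfin)).1
    (hhalf.symm.trans_le hsum)

/-- On the good set the quadratic form is at least κ - B times the squared norm, and the standard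
density is comparable to the tilted one up to exp(-N(2 + γ)η). The cone inequality then leaves only
the mass of the tilted density, which is explicit. -/
theorem le_log_expMean {l : Fin N → ℝ} {κ γ η τ ρ v₀ : ℝ} (hκ : ∀ i, l i < κ) (hγ : 0 < γ)
    (hη : 0 < η) (hηd : η < (Module.finrank ℝ 𝕜 : ℝ) / 2) (hτ : 0 ≤ τ)
    (hτρ : τ + ρ = (Module.finrank ℝ 𝕜 : ℝ) / 2) (i₀ j : Fin N) {D : Set 𝕜}
    (hD : MeasurableSet D) (hDfin : volume D ≠ ⊤) (hv₀ : 0 < v₀) (hvD : v₀ ≤ volume.real D)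
    (hDlow : ∀ y ∈ D, N * τ ≤ ‖y‖ ^ 2) (hDup : ∀ y ∈ D, ‖y‖ ^ 2 ≤ N * (τ + η))
    (hgood : ENNReal.ofReal (1 / 2) *
        ∫⁻ x, ENNReal.ofReal (tiltedDensity i₀ D (fun i => γ * (κ - l i)) x) ≤
      ∫⁻ x in {x : Fin N → 𝕜 | x i₀ ∈ D ∧
        |∑ i ∈ Finset.univ.erase i₀, ‖x i‖ ^ 2 - N * ρ| ≤ N * η ∧
        |∑ i ∈ Finset.univ.erase i₀, (κ - l i) * ‖x i‖ ^ 2 -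
          N * ((Module.finrank ℝ 𝕜 : ℝ) / 2 / γ)| ≤ N * η},
        ENNReal.ofReal (tiltedDensity i₀ D (fun i => γ * (κ - l i)) x)) :
    N * ((Module.finrank ℝ 𝕜 : ℝ) / 2 * γ * (κ - ((κ - l i₀) * (τ + η) +
        (Module.finrank ℝ 𝕜 : ℝ) / 2 / γ + η) / ((Module.finrank ℝ 𝕜 : ℝ) / 2 - η)) -
        (2 + γ) * η - (Module.finrank ℝ 𝕜 : ℝ) / 2 * Real.log γ) -
      (Module.finrank ℝ 𝕜 : ℝ) / 2 * ∑ i, Real.log (κ - l i) +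
      (Real.log (v₀ / 2) - (Module.finrank ℝ 𝕜 : ℝ) / 2 * Real.log Real.pi +
        (Module.finrank ℝ 𝕜 : ℝ) / 2 * Real.log (γ * (κ - l i₀))) ≤
    Real.log (expMean 𝕜 l ((Module.finrank ℝ 𝕜 : ℝ) / 2 * γ) j) := by
  set d := (Module.finrank ℝ 𝕜 : ℝ) with hd
  have hd0 : 0 < d := finrank_real_pos 𝕜
  have hN : (0 : ℝ) < N := by exact_mod_cast i₀.pos
  have hc : ∀ i, 0 < κ - l i := fun i => sub_pos.2 (hκ i)
  have ha : ∀ i, 0 < γ * (κ - l i) := fun i => mul_pos hγ (hc i)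
  set S := {x : Fin N → 𝕜 | x i₀ ∈ D ∧
        |∑ i ∈ Finset.univ.erase i₀, ‖x i‖ ^ 2 - N * ρ| ≤ N * η ∧
        |∑ i ∈ Finset.univ.erase i₀, (κ - l i) * ‖x i‖ ^ 2 - N * (d / 2 / γ)| ≤ N * η} with hS
  have hSm : MeasurableSet S := by
    have h1 : Continuous fun x : Fin N → 𝕜 => ∑ i ∈ Finset.univ.erase i₀, ‖x i‖ ^ 2 := by fun_prop
    have h2 : Continuous fun x : Fin N → 𝕜 =>
      ∑ i ∈ Finset.univ.erase i₀, (κ - l i) * ‖x i‖ ^ 2 := by fun_prop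
    exact (measurable_pi_apply i₀ hD).inter
      ((measurableSet_le ((h1.sub continuous_const).abs).measurable measurable_const).inter
        (measurableSet_le ((h2.sub continuous_const).abs).measurable measurable_const))
  set b := κ - l i₀ with hb
  have hb0 : 0 < b := hc i₀
  -- B is the largest possible value of ∑ (κ - lᵢ)|xᵢ|² on the good set, divided by the least
  -- squared norm there, both per N.
  set B := (b * (τ + η) + d / 2 / γ + η) / (d / 2 - η) with hB
  have hdη : 0 < d / 2 - η := by linarith
  have hB0 : 0 ≤ B := by positivity
  have hsq : ∀ x : Fin N → 𝕜, ∑ i, ‖x i‖ ^ 2 =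
      ‖x i₀‖ ^ 2 + ∑ i ∈ Finset.univ.erase i₀, ‖x i‖ ^ 2 := fun x =>
    (Finset.add_sum_erase _ _ (Finset.mem_univ i₀)).symm
  have hsqS : ∀ x ∈ S, N * (d / 2 - η) ≤ ∑ i, ‖x i‖ ^ 2 := by
    rintro x ⟨h0, h1, -⟩
    rw [hsq]
    have h2 := hDlow _ h0
    have h3 := (abs_le.1 h1).1
    rw [← hτρ]
    linarith
  have hcone := exp_mul_setLIntegral_le_expMean l (d / 2 * γ) (N * (d / 2 * γ * (κ - B))) j hSm
    (fun x hx => lt_of_lt_of_le (by positivity) (hsqS x hx)) (by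
      intro x hx
      have h1 : ∑ i, l i * ‖x i‖ ^ 2 = κ * ∑ i, ‖x i‖ ^ 2 - (b * ‖x i₀‖ ^ 2 +
          ∑ i ∈ Finset.univ.erase i₀, (κ - l i) * ‖x i‖ ^ 2) := by
        rw [hb, Finset.add_sum_erase _ (fun i => (κ - l i) * ‖x i‖ ^ 2) (Finset.mem_univ i₀)]
        simp only [sub_mul, Finset.sum_sub_distrib, Finset.mul_sum]
        ring
      have h2 : b * ‖x i₀‖ ^ 2 + ∑ i ∈ Finset.univ.erase i₀, (κ - l i) * ‖x i‖ ^ 2 ≤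
          B * ∑ i, ‖x i‖ ^ 2 := by
        have h3 : B * (N * (d / 2 - η)) = N * (b * (τ + η) + d / 2 / γ + η) := by
          rw [mul_left_comm, hB, div_mul_cancel₀ _ hdη.ne']
        have h4 := mul_le_mul_of_nonneg_left (hsqS x hx) hB0
        have h5 := mul_le_mul_of_nonneg_left (hDup _ hx.1) hb0.le
        have h6 := (abs_le.1 hx.2.2).2
        linarith
      rw [h1]
      have h7 : (κ - B) * ∑ i, ‖x i‖ ^ 2 ≤ κ * ∑ i, ‖x i‖ ^ 2 - (b * ‖x i₀‖ ^ 2 +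
          ∑ i ∈ Finset.univ.erase i₀, (κ - l i) * ‖x i‖ ^ 2) := by linarith
      have h8 := mul_le_mul_of_nonneg_left h7 (by positivity : 0 ≤ N * (d / 2 * γ))
      linarith)
  -- At the concentration values both exponents equal N(τ + ρ) = Nd/2. The deviations cost 2Nη in
  -- the squared norm (from D and from the other coordinates) and γNη in the weighted sum.
  have hdens : ENNReal.ofReal (Real.exp (-(N * ((2 + γ) * η)))) *
      ∫⁻ x in S, ENNReal.ofReal (tiltedDensity i₀ D (fun i => γ * (κ - l i)) x) ≤
      ∫⁻ x in S, ENNReal.ofReal (Real.exp (-∑ i, ‖x i‖ ^ 2)) := by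
    rw [← lintegral_const_mul' _ _ ENNReal.ofReal_ne_top]
    refine setLIntegral_mono' hSm fun x hx => ?_
    rw [← ENNReal.ofReal_mul (Real.exp_pos _).le]
    refine ENNReal.ofReal_le_ofReal ?_
    rw [tiltedDensity, Set.indicator_of_mem hx.1, Pi.one_apply, one_mul, ← Real.exp_add,
      Real.exp_le_exp, hsq]
    simp only [mul_assoc γ, ← Finset.mul_sum]
    have h2 := hDup _ hx.1
    have h3 := (abs_le.1 hx.2.1).2
    have h4 := mul_le_mul_of_nonneg_left (abs_le.1 hx.2.2).1 hγ.le
    have h5 : γ * (N * (d / 2 / γ)) = N * (τ + ρ) := by rw [hτρ]; field_simp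
    rw [mul_sub, h5] at h4
    linarith
  rw [lintegral_tiltedDensity i₀ hD hDfin ha] at hgood
  rw [Real.le_log_iff_exp_le (expMean_pos _ _ _)]
  have hpi := Real.pi_pos
  have hprod0 : 0 ≤ ∏ i ∈ Finset.univ.erase i₀, (Real.pi / (γ * (κ - l i))) ^ (d / 2) :=
    Finset.prod_nonneg fun i _ => Real.rpow_nonneg (div_pos hpi (ha i)).le _
  have hfinal : ENNReal.ofReal (Real.exp (N * (d / 2 * γ * (κ - B))) *
      (Real.exp (-(N * ((2 + γ) * η))) * (1 / 2 * (v₀ *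
        ∏ i ∈ Finset.univ.erase i₀, (Real.pi / (γ * (κ - l i))) ^ (d / 2))))) ≤
      ENNReal.ofReal (expMean 𝕜 l (d / 2 * γ) j * Real.pi ^ (d / 2 * N)) := by
    rw [ENNReal.ofReal_mul (Real.exp_pos _).le, ENNReal.ofReal_mul (Real.exp_pos _).le,
      ENNReal.ofReal_mul (by norm_num), ENNReal.ofReal_mul (expMean_pos _ _ _).le]
    refine le_trans (mul_le_mul' le_rfl ((mul_le_mul' le_rfl (le_trans (mul_le_mul' le_rfl ?_)
      hgood)).trans hdens)) hcone
    exact ENNReal.ofReal_le_ofReal (mul_le_mul_of_nonneg_right hvD hprod0)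
  have hreal := (ENNReal.ofReal_le_ofReal_iff
    (mul_nonneg (expMean_pos _ _ _).le (Real.rpow_nonneg hpi.le _))).1 hfinal
  rw [← div_le_iff₀ (Real.rpow_pos_of_pos hpi _)] at hreal
  refine le_trans (le_of_eq ?_) hreal
  have hfac : ∀ i, (Real.pi / (γ * (κ - l i))) ^ (d / 2) =
      Real.exp ((Real.log Real.pi - Real.log γ - Real.log (κ - l i)) * (d / 2)) := fun i => by
    rw [Real.rpow_def_of_pos (div_pos hpi (ha i)), Real.log_div hpi.ne' (ha i).ne',
      Real.log_mul hγ.ne' (hc i).ne']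
    congr 1; ring
  -- Coordinate i₀ carries no Gaussian factor; completing the product to all indices produces the
  -- bounded correction involving γ(κ - l i₀).
  have hcard : ((Finset.univ.erase i₀).card : ℝ) = N - 1 := by
    rw [Finset.card_erase_of_mem (Finset.mem_univ _), Finset.card_univ, Fintype.card_fin,
      Nat.cast_sub i₀.pos]
    simp
  have hlogsum : ∑ i ∈ Finset.univ.erase i₀, Real.log (κ - l i) =
      ∑ i, Real.log (κ - l i) - Real.log b := by
    rw [← Finset.add_sum_erase _ _ (Finset.mem_univ i₀)]; ring
  simp_rw [hfac]
  rw [← Real.exp_sum, Real.rpow_def_of_pos hpi, ← Finset.sum_mul, Finset.sum_sub_distrib,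
    Finset.sum_const, nsmul_eq_mul, hcard, hlogsum, Real.log_mul hγ.ne' hb0.ne']
  have hv : (1 / 2 * (v₀ * Real.exp (((N - 1) * (Real.log Real.pi - Real.log γ) -
      (∑ i, Real.log (κ - l i) - Real.log b)) * (d / 2)))) = Real.exp (Real.log (v₀ / 2) +
      ((N - 1) * (Real.log Real.pi - Real.log γ) -
      (∑ i, Real.log (κ - l i) - Real.log b)) * (d / 2)) := by
    rw [Real.exp_add, Real.exp_log (by positivity)]; ring
  rw [hv, ← Real.exp_add, ← Real.exp_add, ← Real.exp_sub]
  congr 1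
  ring

end LowerBound

/-! ### Concentration of the tilted density and the asymptotic lower bound -/

section EventualLowerBound

variable {𝕜 : Type*} [RCLike 𝕜]

/-- A weak law of large numbers: under weight aᵢ the mean of cᵢ|xᵢ|² is (d/2)cᵢ/aᵢ. Chernoff's bound
with s · c for a small fixed s gives exponential decay in N, uniformly in the excluded coordinate
and in D. -/
theorem eventually_setLIntegral_tiltedDensity_le {a c : ∀ N, Fin N → ℝ} {M r η : ℝ}
    (ha : ∀ᶠ N in atTop, ∀ i, 0 < a N i) (hM : ∀ᶠ N in atTop, ∀ i, |c N i / a N i| ≤ M)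
    (hr : Tendsto (fun N : ℕ => 1 / (N : ℝ) * ∑ i, c N i / a N i) atTop (𝓝 r)) (hη : 0 < η) :
    ∀ᶠ N : ℕ in atTop, ∀ (i₀ : Fin N) (D : Set 𝕜), MeasurableSet D → volume D ≠ ⊤ →
      ∫⁻ x in {x : Fin N → 𝕜 | N * ((Module.finrank ℝ 𝕜 : ℝ) / 2 * r) + N * η ≤
        ∑ i ∈ Finset.univ.erase i₀, c N i * ‖x i‖ ^ 2},
          ENNReal.ofReal (tiltedDensity i₀ D (a N) x) ≤
        ENNReal.ofReal (1 / 8) * ∫⁻ x, ENNReal.ofReal (tiltedDensity i₀ D (a N) x) := by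
  set d := (Module.finrank ℝ 𝕜 : ℝ) with hd
  have hd0 : 0 < d := finrank_real_pos 𝕜
  set K := |M| + 1 with hK
  have hK1 : 1 ≤ K := by rw [hK]; linarith [abs_nonneg M]
  have hMK : M ≤ K := by rw [hK]; linarith [le_abs_self M]
  -- The first entry makes |s c/a| ≤ 1/2, as the Chernoff bound requires; the second makes the
  -- quadratic error at most sNη/4. The error of the mean and the omitted index cost sNη/8 each, so
  -- the exponent is at most -sNη/2, which `e3` brings below log(1/8).
  set s := min (1 / (2 * K)) (η / (4 * d * K ^ 2)) with hs
  have hs0 : 0 < s := lt_min (by positivity) (by positivity)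
  have hsK : s * K ≤ 1 / 2 := by
    have h := mul_le_mul_of_nonneg_right (min_le_left (1 / (2 * K)) (η / (4 * d * K ^ 2)))
      (by linarith : 0 ≤ K)
    rw [← hs] at h
    refine h.trans_eq ?_
    field_simp
  have hsK2 : s * (d * K ^ 2) ≤ η / 4 := by
    have h := mul_le_mul_of_nonneg_right (min_le_right (1 / (2 * K)) (η / (4 * d * K ^ 2)))
      (by positivity : 0 ≤ d * K ^ 2)
    rw [← hs] at h
    refine h.trans_eq ?_
    field_simp
  have e1 : ∀ᶠ N : ℕ in atTop, 1 / (N : ℝ) * ∑ i, c N i / a N i < r + η / (4 * d) :=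
    hr.eventually_lt_const (by linarith [show 0 < η / (4 * d) by positivity])
  have e2 : ∀ᶠ N : ℕ in atTop, 4 * d * K / η ≤ (N : ℝ) :=
    tendsto_natCast_atTop_atTop.eventually_ge_atTop _
  have e3 : ∀ᶠ N : ℕ in atTop, -Real.log (1 / 8) * 2 / (s * η) ≤ (N : ℝ) :=
    tendsto_natCast_atTop_atTop.eventually_ge_atTop _
  filter_upwards [ha, hM, e1, e2, e3, eventually_gt_atTop 0] with N hNa hNM h1 h2 h3 hN0 i₀ D hD hDf
  have hN : (0 : ℝ) < N := by exact_mod_cast hN0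
  have hcK : ∀ i, |c N i / a N i| ≤ K := fun i => (hNM i).trans hMK
  have hsc : ∀ i, s * c N i / a N i = s * (c N i / a N i) := fun i => mul_div_assoc _ _ _
  have hch := setLIntegral_tiltedDensity_le i₀ hD hDf hNa (fun i => s * c N i)
    (s * (N * (d / 2 * r) + N * η)) (fun i => by
      rw [hsc, abs_mul, abs_of_pos hs0]
      exact (mul_le_mul_of_nonneg_left (hcK i) hs0.le).trans hsK)
  refine (lintegral_mono_set fun x hx => ?_).trans (hch.trans (mul_le_mul' ?_ le_rfl))
  · have hx' : N * (d / 2 * r) + N * η ≤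
        ∑ i ∈ Finset.univ.erase i₀, c N i * ‖x i‖ ^ 2 := hx
    have := mul_le_mul_of_nonneg_left hx' hs0.le
    simpa only [Set.mem_ofPred_eq, mul_assoc, Finset.mul_sum] using this
  · refine ENNReal.ofReal_le_ofReal ?_
    rw [← Real.le_log_iff_exp_le (by norm_num)]
    simp only [hsc]
    have hsum1 : ∑ i ∈ Finset.univ.erase i₀, c N i / a N i ≤ N * (r + η / (4 * d)) + K := by
      have h4 := Finset.add_sum_erase Finset.univ (fun i => c N i / a N i) (Finset.mem_univ i₀)
      have h5 := (abs_le.1 (hcK i₀)).1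
      have h6 : ∑ i, c N i / a N i ≤ N * (r + η / (4 * d)) := by
        rw [one_div, inv_mul_lt_iff₀ hN] at h1
        exact h1.le
      linarith
    have hsum2 : ∑ i ∈ Finset.univ.erase i₀, (c N i / a N i) ^ 2 ≤ N * K ^ 2 := by
      calc _ ≤ ∑ i, (c N i / a N i) ^ 2 :=
            Finset.sum_le_sum_of_subset_of_nonneg (Finset.erase_subset _ _)
              fun _ _ _ => sq_nonneg _
        _ ≤ ∑ _i : Fin N, K ^ 2 := Finset.sum_le_sum fun i _ => sq_le_sq' (by
            linarith [(abs_le.1 (hcK i)).1]) (abs_le.1 (hcK i)).2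
        _ = N * K ^ 2 := by simp
    rw [Finset.sum_add_distrib]
    simp only [mul_pow, ← Finset.mul_sum]
    rw [div_le_iff₀ hη] at h2
    rw [div_le_iff₀ (by positivity)] at h3
    have hd4 : d * (N * (r + η / (4 * d))) = N * (d * r) + N * η / 4 := by field_simp
    have g1 := mul_le_mul_of_nonneg_left hsum1 (by positivity : 0 ≤ d / 2 * s)
    have g2 := mul_le_mul_of_nonneg_left hsum2 (by positivity : 0 ≤ d * s ^ 2)
    have g3 := mul_le_mul_of_nonneg_left hsK2 (by positivity : 0 ≤ s * N)
    have g4 := mul_le_mul_of_nonneg_left h2 (by positivity : 0 ≤ s / 8)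
    have g5 := congrArg (fun y => s / 2 * y) hd4
    linarith

/-- A ball inside the annulus, scaled by √N ≥ 1: its volume is at least that of the unscaled ball,
so log v₀ is negligible after division by N. -/
theorem exists_ball_normSq_mem (𝕜 : Type*) [RCLike 𝕜] {τ η : ℝ} (hτ : 0 ≤ τ) (hη : 0 < η) :
    ∃ v₀ : ℝ, 0 < v₀ ∧ ∀ N : ℕ, 0 < N → ∃ D : Set 𝕜, MeasurableSet D ∧ volume D ≠ ⊤ ∧
      v₀ ≤ volume.real D ∧ (∀ y ∈ D, N * τ ≤ ‖y‖ ^ 2) ∧ ∀ y ∈ D, ‖y‖ ^ 2 ≤ N * (τ + η) := by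
  set A := √τ with hA
  set B := √(τ + η) with hB
  have hAB : A < B := Real.sqrt_lt_sqrt hτ (by linarith)
  have hA0 : 0 ≤ A := Real.sqrt_nonneg _
  have hA2 : A ^ 2 = τ := Real.sq_sqrt hτ
  have hB2 : B ^ 2 = τ + η := Real.sq_sqrt (by linarith)
  have hr : 0 < (B - A) / 2 := by linarith
  refine ⟨volume.real (Metric.closedBall (0 : 𝕜) ((B - A) / 2)), ?_, fun N hN => ?_⟩
  · exact ENNReal.toReal_pos (Metric.measure_closedBall_pos _ _ hr).ne'
      (isCompact_closedBall _ _).measure_lt_top.ne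
  have hN1 : (1 : ℝ) ≤ N := by exact_mod_cast hN
  set n := √(N : ℝ) with hn
  have hn1 : 1 ≤ n := Real.one_le_sqrt.2 hN1
  have hn2 : n ^ 2 = N := Real.sq_sqrt (by linarith)
  have hball : ∀ y ∈ Metric.closedBall ((n * ((A + B) / 2) : ℝ) : 𝕜) (n * ((B - A) / 2)),
      n * A ≤ ‖y‖ ∧ ‖y‖ ≤ n * B := by
    intro y hy
    rw [mem_closedBall_iff_norm] at hy
    have hc : ‖((n * ((A + B) / 2) : ℝ) : 𝕜)‖ = n * ((A + B) / 2) := by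
      rw [RCLike.norm_ofReal, abs_of_nonneg]
      exact mul_nonneg (by linarith) (by linarith)
    have h1 := norm_sub_norm_le y ((n * ((A + B) / 2) : ℝ) : 𝕜)
    have h2 := norm_sub_norm_le ((n * ((A + B) / 2) : ℝ) : 𝕜) y
    rw [norm_sub_rev] at h2
    rw [hc] at h1 h2
    constructor <;> linarith
  refine ⟨Metric.closedBall ((n * ((A + B) / 2) : ℝ) : 𝕜) (n * ((B - A) / 2)),
    measurableSet_closedBall, (isCompact_closedBall _ _).measure_lt_top.ne, ?_,
    fun y hy => ?_, fun y hy => ?_⟩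
  · unfold Measure.real
    rw [Measure.addHaar_closedBall_center volume ((n * ((A + B) / 2) : ℝ) : 𝕜)]
    refine ENNReal.toReal_mono (isCompact_closedBall _ _).measure_lt_top.ne (measure_mono
      (Metric.closedBall_subset_closedBall (le_mul_of_one_le_left hr.le hn1)))
  · rw [← hn2, ← hA2, ← mul_pow]
    exact pow_le_pow_left₀ (by positivity) (hball y hy).1 2
  · rw [← hn2, ← hB2, ← mul_pow]
    exact pow_le_pow_left₀ (norm_nonneg _) (hball y hy).2 2

theorem eventually_le_log_expMean {l : ∀ N, Fin N → ℝ} {κ γ m h ε : ℝ} (hγ : 0 < γ) (hm : m < κ)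
    (hmax : ∀ δ > 0, ∀ᶠ N in atTop, ∀ i, l N i ≤ m + δ)
    (htop : ∀ δ > 0, ∀ᶠ N in atTop, ∃ i, m - δ ≤ l N i)
    (hh : Tendsto (fun N : ℕ => 1 / (N : ℝ) * ∑ i, (κ - l N i)⁻¹) atTop (𝓝 h)) (hhγ : h ≤ γ)
    (hε : 0 < ε) :
    ∀ᶠ N : ℕ in atTop, ∀ j, (Module.finrank ℝ 𝕜 : ℝ) / 2 *
      (γ * κ - 1 - (γ - h) * (κ - m) - Real.log γ - 1 / (N : ℝ) * ∑ i, Real.log (κ - l N i)) - ε ≤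
        1 / (N : ℝ) * Real.log (expMean 𝕜 (l N) ((Module.finrank ℝ 𝕜 : ℝ) / 2 * γ) j) := by
  set d := (Module.finrank ℝ 𝕜 : ℝ) with hd
  have hd0 : 0 < d := finrank_real_pos 𝕜
  -- The squared norm per N missing from the Gaussian coordinates; it is nonnegative because h ≤ γ.
  set τ := d / 2 - d / 2 * (h / γ) with hτ
  have hτ0 : 0 ≤ τ := by
    have : h / γ ≤ 1 := (div_le_one hγ).2 hhγ
    rw [hτ]; nlinarith
  -- The leading rate of `le_log_expMean` with κ - l i₀ replaced by its upper bound κ - m + η. Its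
  -- value at η = 0 is the target, and continuity there provides η.
  set φ : ℝ → ℝ := fun η => d / 2 * γ * (κ - ((κ - m + η) * (τ + η) + d / 2 / γ + η) /
    (d / 2 - η)) - (2 + γ) * η with hφ
  have hφ0 : φ 0 = d / 2 * (γ * κ - 1 - (γ - h) * (κ - m)) := by
    simp only [hφ, hτ, sub_zero, add_zero, mul_zero]; field_simp; ring
  have hφc : ContinuousAt φ 0 := by
    have : d / 2 - 0 ≠ 0 := by rw [sub_zero]; positivity
    fun_prop (disch := assumption)
  obtain ⟨η, hη0, hηd, hηφ⟩ : ∃ η, 0 < η ∧ η < d / 2 ∧ φ 0 - ε / 2 < φ η := by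
    have h1 : ∀ᶠ η in 𝓝[>] (0 : ℝ), φ 0 - ε / 2 < φ η :=
      (hφc.tendsto.mono_left nhdsWithin_le_nhds).eventually_const_lt (by linarith)
    have h2 : ∀ᶠ η in 𝓝[>] (0 : ℝ), η < d / 2 :=
      (tendsto_id.mono_left nhdsWithin_le_nhds).eventually_lt_const (by simpa using hd0)
    obtain ⟨η, h3, h4, h5⟩ := (h1.and (h2.and self_mem_nhdsWithin)).exists
    exact ⟨η, h5, h4, h3⟩
  obtain ⟨v₀, hv₀, hball⟩ := exists_ball_normSq_mem 𝕜 hτ0 hη0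
  have hlow : 0 < (κ - m) / 2 := by linarith
  have hgap : ∀ᶠ N in atTop, ∀ i, (κ - m) / 2 ≤ κ - l N i := by
    filter_upwards [hmax _ hlow] with N hN i
    linarith [hN i]
  have hapos : ∀ᶠ N in atTop, ∀ i, 0 < γ * (κ - l N i) := by
    filter_upwards [hgap] with N hN i
    exact mul_pos hγ (hlow.trans_le (hN i))
  have hcT : ∀ᶠ N in atTop, ∀ i, |1 / (γ * (κ - l N i))| ≤ 1 / (γ * ((κ - m) / 2)) := by
    filter_upwards [hgap, hapos] with N hN hN' i
    rw [abs_of_pos (one_div_pos.2 (hN' i))]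
    exact one_div_le_one_div_of_le (by positivity) (mul_le_mul_of_nonneg_left (hN i) hγ.le)
  have hrT : Tendsto (fun N : ℕ => 1 / (N : ℝ) * ∑ i, 1 / (γ * (κ - l N i))) atTop
      (𝓝 (h / γ)) := by
    refine (hh.div_const γ).congr fun N => ?_
    rw [mul_div_assoc, Finset.sum_div]
    congr 1
    exact Finset.sum_congr rfl fun i _ => by rw [one_div, mul_inv, div_eq_mul_inv, mul_comm]
  have hquot : ∀ᶠ N in atTop, ∀ i, (κ - l N i) / (γ * (κ - l N i)) = 1 / γ := by
    filter_upwards [hgap] with N hN i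
    have : κ - l N i ≠ 0 := (hlow.trans_le (hN i)).ne'
    field_simp
  have hcQ : ∀ᶠ N in atTop, ∀ i, |(κ - l N i) / (γ * (κ - l N i))| ≤ 1 / γ := by
    filter_upwards [hquot] with N hN i
    rw [hN i, abs_of_pos (one_div_pos.2 hγ)]
  have hrQ : Tendsto (fun N : ℕ => 1 / (N : ℝ) * ∑ i, (κ - l N i) / (γ * (κ - l N i))) atTop
      (𝓝 (1 / γ)) := by
    refine tendsto_const_nhds.congr' ?_
    filter_upwards [hquot, eventually_gt_atTop 0] with N hN hN0
    have : (N : ℝ) ≠ 0 := by exact_mod_cast hN0.ne'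
    simp only [hN, Finset.sum_const, Finset.card_univ, Fintype.card_fin, nsmul_eq_mul]
    field_simp
  -- Upper and lower tails of the squared norm (`t₁`, `t₂`), then of the weighted sum (`t₃`, `t₄`).
  have t₁ := eventually_setLIntegral_tiltedDensity_le (𝕜 := 𝕜) (c := fun _ _ => 1) hapos hcT hrT hη0
  have t₂ := eventually_setLIntegral_tiltedDensity_le (𝕜 := 𝕜) (c := fun _ _ => -1) hapos
    (M := 1 / (γ * ((κ - m) / 2))) (by simpa only [neg_div, abs_neg] using hcT)
    (r := -(h / γ)) (by simpa only [neg_div, Finset.sum_neg_distrib, mul_neg] using hrT.neg) hη0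
  have t₃ := eventually_setLIntegral_tiltedDensity_le (𝕜 := 𝕜) hapos hcQ hrQ hη0
  have t₄ := eventually_setLIntegral_tiltedDensity_le (𝕜 := 𝕜) (c := fun N i => -(κ - l N i)) hapos
    (M := 1 / γ) (by simpa only [neg_div, abs_neg] using hcQ)
    (r := -(1 / γ)) (by simpa only [neg_div, Finset.sum_neg_distrib, mul_neg] using hrQ.neg) hη0
  set C := Real.log (v₀ / 2) - d / 2 * Real.log Real.pi +
    d / 2 * Real.log (γ * ((κ - m) / 2)) with hC
  have hCN : ∀ᶠ N : ℕ in atTop, -(ε / 2) < 1 / (N : ℝ) * C := by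
    have : Tendsto (fun N : ℕ => 1 / (N : ℝ) * C) atTop (𝓝 (0 * C)) :=
      tendsto_one_div_atTop_nhds_zero_nat.mul_const C
    rw [zero_mul] at this
    exact this.eventually_const_lt (by linarith)
  filter_upwards [t₁, t₂, t₃, t₄, hgap, hapos, hCN, htop η hη0, eventually_gt_atTop 0] with N
    t₁ t₂ t₃ t₄ hgap hapos hCN htop hN0 j
  have hN : (0 : ℝ) < N := by exact_mod_cast hN0
  obtain ⟨i₀, hi₀⟩ := htop
  obtain ⟨D, hDm, hDf, hvD, hDlow, hDup⟩ := hball N hN0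
  have hgood := half_lintegral_tiltedDensity_le i₀ hDm hDf hapos
    (fun x : Fin N → 𝕜 => ∑ i ∈ Finset.univ.erase i₀, ‖x i‖ ^ 2)
    (fun x : Fin N → 𝕜 => ∑ i ∈ Finset.univ.erase i₀, (κ - l N i) * ‖x i‖ ^ 2)
    (Continuous.measurable (by fun_prop)) (Continuous.measurable (by fun_prop))
    (N * (d / 2 * (h / γ))) (N * (d / 2 / γ)) (N * η)
    ((lintegral_mono_set fun x hx => by
      simpa only [Set.mem_ofPred_eq, one_mul] using hx).trans (t₁ i₀ D hDm hDf))
    ((lintegral_mono_set fun x hx => by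
      simpa only [Set.mem_ofPred_eq, neg_mul, one_mul, Finset.sum_neg_distrib, mul_neg]
        using hx).trans (t₂ i₀ D hDm hDf))
    ((lintegral_mono_set fun x hx => by
      simpa only [Set.mem_ofPred_eq, mul_one_div] using hx).trans (t₃ i₀ D hDm hDf))
    ((lintegral_mono_set fun x hx => by
      simpa only [Set.mem_ofPred_eq, neg_mul, Finset.sum_neg_distrib, mul_neg, mul_one_div]
        using hx).trans (t₄ i₀ D hDm hDf))
  have hκl : ∀ i, l N i < κ := fun i => by linarith [hgap i]
  have hmain := le_log_expMean (𝕜 := 𝕜) hκl hγ hη0 hηd hτ0 (by rw [hτ, sub_add_cancel]) i₀ j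
    hDm hDf hv₀ hvD hDlow hDup hgood
  have hb : φ η ≤ d / 2 * γ * (κ - ((κ - l N i₀) * (τ + η) + d / 2 / γ + η) / (d / 2 - η)) -
      (2 + γ) * η := by
    simp only [hφ]
    have : κ - l N i₀ ≤ κ - m + η := by linarith
    have h0 : 0 < d / 2 - η := by linarith
    gcongr
  have hClog : C ≤ Real.log (v₀ / 2) - d / 2 * Real.log Real.pi +
      d / 2 * Real.log (γ * (κ - l N i₀)) := by
    have : Real.log (γ * ((κ - m) / 2)) ≤ Real.log (γ * (κ - l N i₀)) :=
      Real.log_le_log (by positivity) (mul_le_mul_of_nonneg_left (hgap i₀) hγ.le)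
    have := mul_le_mul_of_nonneg_left this (by positivity : 0 ≤ d / 2)
    rw [hC]; linarith
  rw [hφ0] at hηφ
  have hNb := mul_le_mul_of_nonneg_left hb hN.le
  have htot : N * (φ η - d / 2 * Real.log γ) - d / 2 * ∑ i, Real.log (κ - l N i) + C ≤
      Real.log (expMean 𝕜 (l N) (d / 2 * γ) j) := by linarith
  have hdivN := mul_le_mul_of_nonneg_left htot (by positivity : (0 : ℝ) ≤ 1 / N)
  have hexp : 1 / (N : ℝ) * (N * (φ η - d / 2 * Real.log γ) - d / 2 * ∑ i, Real.log (κ - l N i) + C)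
      = φ η - d / 2 * Real.log γ - d / 2 * (1 / (N : ℝ) * ∑ i, Real.log (κ - l N i)) +
        1 / (N : ℝ) * C := by
    field_simp
  rw [hexp] at hdivN
  linarith

end EventualLowerBound

/-! ### The Cauchy mean and the logarithmic potential, up to the endpoint -/

section CauchyMean

variable {μ : Measure ℝ} [IsProbabilityMeasure μ] {X : ℝ → ℝ} {L m : ℝ}

/-- The mean of `(z - X)⁻¹`. -/
noncomputable def cauchyMean (μ : Measure ℝ) (X : ℝ → ℝ) (z : ℝ) : ℝ := ∫ x, (z - X x)⁻¹ ∂μ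

theorem integrable_inv_sub (hX : Measurable X) (hm : ∀ᵐ x ∂μ, X x ≤ m) {z : ℝ} (hz : m < z) :
    Integrable (fun x => (z - X x)⁻¹) μ := by
  refine Integrable.of_bound (C := (z - m)⁻¹) (by fun_prop) ?_
  filter_upwards [hm] with x hx
  rw [Real.norm_of_nonneg (inv_nonneg.2 (by linarith))]
  exact inv_anti₀ (by linarith) (by linarith)

theorem cauchyMean_le (hX : Measurable X) (hm : ∀ᵐ x ∂μ, X x ≤ m) {z : ℝ} (hz : m < z) :
    cauchyMean μ X z ≤ (z - m)⁻¹ := by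
  have h : cauchyMean μ X z ≤ ∫ _x, (z - m)⁻¹ ∂μ := by
    refine integral_mono_ae (integrable_inv_sub hX hm hz) (integrable_const _) ?_
    filter_upwards [hm] with x hx
    exact inv_anti₀ (by linarith) (by linarith)
  simpa using h

theorem le_cauchyMean (hX : Measurable X) (hL : ∀ᵐ x ∂μ, L ≤ X x) (hm : ∀ᵐ x ∂μ, X x ≤ m)
    {z : ℝ} (hz : m < z) : (z - L)⁻¹ ≤ cauchyMean μ X z := by
  have h : ∫ _x, (z - L)⁻¹ ∂μ ≤ cauchyMean μ X z := by
    refine integral_mono_ae (integrable_const _) (integrable_inv_sub hX hm hz) ?_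
    filter_upwards [hm, hL] with x hx hx'
    exact inv_anti₀ (by linarith) (by linarith)
  simpa using h

theorem le_of_ae_bounds (hL : ∀ᵐ x ∂μ, L ≤ X x) (hm : ∀ᵐ x ∂μ, X x ≤ m) : L ≤ m := by
  obtain ⟨x, h1, h2⟩ := (hL.and hm).exists
  exact h1.trans h2

theorem cauchyMean_pos (hX : Measurable X) (hL : ∀ᵐ x ∂μ, L ≤ X x) (hm : ∀ᵐ x ∂μ, X x ≤ m)
    {z : ℝ} (hz : m < z) : 0 < cauchyMean μ X z :=
  (inv_pos.2 (by linarith [le_of_ae_bounds hL hm])).trans_le (le_cauchyMean hX hL hm hz)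

theorem strictAntiOn_cauchyMean (hX : Measurable X) (hL : ∀ᵐ x ∂μ, L ≤ X x)
    (hm : ∀ᵐ x ∂μ, X x ≤ m) : StrictAntiOn (cauchyMean μ X) (Set.Ioi m) := by
  intro z hz w hw hzw
  rw [Set.mem_Ioi] at hz hw
  have hLm := le_of_ae_bounds hL hm
  have h : ∫ _x, (w - z) * ((z - L)⁻¹ * (w - L)⁻¹) ∂μ ≤
      ∫ x, ((z - X x)⁻¹ - (w - X x)⁻¹) ∂μ := by
    refine integral_mono_ae (integrable_const _)
      ((integrable_inv_sub hX hm hz).sub (integrable_inv_sub hX hm hw)) ?_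
    filter_upwards [hm, hL] with x hx hx'
    have h1 : 0 < z - X x := by linarith
    have h2 : 0 < w - X x := by linarith
    have h3 : (z - X x)⁻¹ - (w - X x)⁻¹ = (w - z) * ((z - X x)⁻¹ * (w - X x)⁻¹) := by
      field_simp; ring
    rw [h3]
    exact mul_le_mul_of_nonneg_left (mul_le_mul (inv_anti₀ h1 (by linarith))
      (inv_anti₀ h2 (by linarith)) (inv_nonneg.2 (by linarith)) (inv_nonneg.2 h1.le))
      (by linarith)
  rw [integral_sub (integrable_inv_sub hX hm hz) (integrable_inv_sub hX hm hw)] at h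
  have hpos : 0 < (w - z) * ((z - L)⁻¹ * (w - L)⁻¹) :=
    mul_pos (by linarith) (mul_pos (inv_pos.2 (by linarith)) (inv_pos.2 (by linarith)))
  simp only [integral_const, probReal_univ, one_smul] at h
  unfold cauchyMean
  linarith

theorem continuousAt_cauchyMean (hX : Measurable X) (hm : ∀ᵐ x ∂μ, X x ≤ m) {z : ℝ}
    (hz : m < z) : ContinuousAt (cauchyMean μ X) z := by
  refine continuousAt_of_dominated (bound := fun _ => ((z - m) / 2)⁻¹)
    (Eventually.of_forall fun w => by fun_prop) ?_ (integrable_const _) ?_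
  · filter_upwards [lt_mem_nhds (show (m + z) / 2 < z by linarith)] with w hw
    filter_upwards [hm] with x hx
    rw [Real.norm_of_nonneg (inv_nonneg.2 (by linarith))]
    exact inv_anti₀ (by linarith) (by linarith)
  · filter_upwards [hm] with x hx
    have : z - X x ≠ 0 := by linarith
    fun_prop (disch := assumption)

theorem tendsto_cauchyMean_nhdsGT (hX : Measurable X) (hL : ∀ᵐ x ∂μ, L ≤ X x)
    (hm : ∀ᵐ x ∂μ, X x ≤ m) :
    Tendsto (fun z => (cauchyMean μ X z : EReal)) (𝓝[>] m)
      (𝓝 (sSup ((fun z => (cauchyMean μ X z : EReal)) '' Set.Ioi m))) :=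
  AntitoneOn.tendsto_nhdsGT (fun _ hz _ hw hzw => EReal.coe_le_coe_iff.2
    ((strictAntiOn_cauchyMean hX hL hm).antitoneOn hz hw hzw)) (OrderTop.bddAbove _)

theorem exists_cauchyMean_eq (hX : Measurable X) (hL : ∀ᵐ x ∂μ, L ≤ X x)
    (hm : ∀ᵐ x ∂μ, X x ≤ m) {γ : ℝ} (hγ : 0 < γ)
    (h : (γ : EReal) < sSup ((fun z => (cauchyMean μ X z : EReal)) '' Set.Ioi m)) :
    ∃ κ, m < κ ∧ cauchyMean μ X κ = γ := by
  obtain ⟨_, ⟨z, hz, rfl⟩, hγz⟩ := lt_sSup_iff.1 h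
  rw [Set.mem_Ioi] at hz
  have hγz' : γ < cauchyMean μ X z := EReal.coe_lt_coe_iff.1 hγz
  -- The bound (z - m)⁻¹ on the Cauchy mean equals γ at z = m + γ⁻¹, which gives the right end for
  -- the intermediate value theorem.
  have hw : m < m + γ⁻¹ := by linarith [inv_pos.2 hγ]
  have hγw : cauchyMean μ X (m + γ⁻¹) ≤ γ := by
    refine (cauchyMean_le hX hm hw).trans_eq ?_
    rw [add_sub_cancel_left, inv_inv]
  have hzw : z ≤ m + γ⁻¹ := by
    by_contra! hlt
    have := strictAntiOn_cauchyMean hX hL hm hw hz hlt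
    linarith
  obtain ⟨κ, hκ, hκγ⟩ := intermediate_value_Icc' hzw (f := cauchyMean μ X)
    (fun x hx => (continuousAt_cauchyMean hX hm (hz.trans_le hx.1)).continuousWithinAt)
    ⟨hγw, hγz'.le⟩
  exact ⟨κ, hz.trans_le hκ.1, hκγ⟩

theorem cauchyMean_lt_of_sSup_le (hX : Measurable X) (hL : ∀ᵐ x ∂μ, L ≤ X x)
    (hm : ∀ᵐ x ∂μ, X x ≤ m) {γ : ℝ}
    (h : sSup ((fun z => (cauchyMean μ X z : EReal)) '' Set.Ioi m) ≤ γ) {z : ℝ} (hz : m < z) :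
    cauchyMean μ X z < γ := by
  have hmid : m < (m + z) / 2 := by linarith
  have h1 := strictAntiOn_cauchyMean hX hL hm hmid hz (by linarith)
  have h2 : (cauchyMean μ X ((m + z) / 2) : EReal) ≤ γ :=
    (le_sSup (Set.mem_image_of_mem _ hmid)).trans h
  exact h1.trans_le (EReal.coe_le_coe_iff.1 h2)

theorem integrable_log_sub (hX : Measurable X) (hL : ∀ᵐ x ∂μ, L ≤ X x)
    (hm : ∀ᵐ x ∂μ, X x ≤ m) {κ : ℝ} (hκ : m < κ) :
    Integrable (fun x => Real.log (κ - X x)) μ := by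
  refine Integrable.of_bound (C := |Real.log (κ - m)| + |Real.log (κ - L)|)
    (Real.measurable_log.comp (by fun_prop)).aestronglyMeasurable ?_
  filter_upwards [hm, hL] with x hx hx'
  have h1 := Real.log_le_log (show 0 < κ - m by linarith) (show κ - m ≤ κ - X x by linarith)
  have h2 := Real.log_le_log (show 0 < κ - X x by linarith) (show κ - X x ≤ κ - L by linarith)
  rw [Real.norm_eq_abs, abs_le]
  constructor
  · linarith [neg_abs_le (Real.log (κ - m)), abs_nonneg (Real.log (κ - L))]
  · linarith [le_abs_self (Real.log (κ - L)), abs_nonneg (Real.log (κ - m))]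

section Critical

variable {γ : ℝ}

/-- Fatou's lemma as z decreases to m. The inverse in `ENNReal` is infinite where X = m, so the
finite bound also rules out an atom at m. -/
theorem lintegral_inv_sub_le (hX : Measurable X) (hm : ∀ᵐ x ∂μ, X x ≤ m)
    (h : ∀ z, m < z → cauchyMean μ X z < γ) :
    ∫⁻ x, (ENNReal.ofReal (m - X x))⁻¹ ∂μ ≤ ENNReal.ofReal γ := by
  set z : ℕ → ℝ := fun n => m + 1 / ((n : ℝ) + 1) with hz
  have hzm : ∀ n, m < z n := fun n => by
    have : (0 : ℝ) < 1 / ((n : ℝ) + 1) := by positivity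
    simp only [hz]; linarith
  have hlim : Tendsto z atTop (𝓝 m) := by
    simpa [hz] using tendsto_const_nhds.add (tendsto_one_div_add_atTop_nhds_zero_nat (𝕜 := ℝ))
  have h1 : ∀ x, (ENNReal.ofReal (m - X x))⁻¹ =
      liminf (fun n => (ENNReal.ofReal (z n - X x))⁻¹) atTop := fun x =>
    ((tendsto_inv_iff.2 (ENNReal.tendsto_ofReal (hlim.sub_const (X x)))).liminf_eq).symm
  simp_rw [h1]
  refine (lintegral_liminf_le fun n => by fun_prop).trans ?_
  refine liminf_le_of_frequently_le' (Eventually.frequently (Eventually.of_forall fun n => ?_))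
  have h2 : ∫⁻ x, (ENNReal.ofReal (z n - X x))⁻¹ ∂μ =
      ∫⁻ x, ENNReal.ofReal ((z n - X x)⁻¹) ∂μ := by
    refine lintegral_congr_ae ?_
    filter_upwards [hm] with x hx
    rw [ENNReal.ofReal_inv_of_pos (by linarith [hzm n])]
  rw [h2, ← ofReal_integral_eq_lintegral_ofReal (integrable_inv_sub hX hm (hzm n))]
  · exact ENNReal.ofReal_le_ofReal (h _ (hzm n)).le
  · filter_upwards [hm] with x hx
    exact inv_nonneg.2 (by linarith [hzm n])

theorem ae_lt_of_cauchyMean_lt (hX : Measurable X) (hm : ∀ᵐ x ∂μ, X x ≤ m)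
    (h : ∀ z, m < z → cauchyMean μ X z < γ) : ∀ᵐ x ∂μ, X x < m := by
  have h1 := ae_lt_top (by fun_prop)
    ((lintegral_inv_sub_le hX hm h).trans_lt ENNReal.ofReal_lt_top).ne
  filter_upwards [h1] with x hx
  rw [ENNReal.inv_lt_top, ENNReal.ofReal_pos] at hx
  linarith

theorem integrable_inv_sub_of_cauchyMean_lt (hX : Measurable X) (hm : ∀ᵐ x ∂μ, X x ≤ m)
    (h : ∀ z, m < z → cauchyMean μ X z < γ) :
    Integrable (fun x => (m - X x)⁻¹) μ ∧ ∫ x, (m - X x)⁻¹ ∂μ ≤ γ := by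
  have hlt := ae_lt_of_cauchyMean_lt hX hm h
  have h1 : ∫⁻ x, ENNReal.ofReal ((m - X x)⁻¹) ∂μ ≤ ENNReal.ofReal γ := by
    refine le_trans (le_of_eq (lintegral_congr_ae ?_)) (lintegral_inv_sub_le hX hm h)
    filter_upwards [hlt] with x hx
    rw [ENNReal.ofReal_inv_of_pos (by linarith)]
  have h0 : 0 ≤ᵐ[μ] fun x => (m - X x)⁻¹ := by
    filter_upwards [hlt] with x hx
    exact inv_nonneg.2 (by linarith)
  have hi : Integrable (fun x => (m - X x)⁻¹) μ := by
    refine ⟨by fun_prop, ?_⟩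
    rw [hasFiniteIntegral_iff_ofReal h0]
    exact h1.trans_lt ENNReal.ofReal_lt_top
  refine ⟨hi, ?_⟩
  rw [← ofReal_integral_eq_lintegral_ofReal hi h0] at h1
  by_cases hγ : 0 ≤ γ
  · exact (ENNReal.ofReal_le_ofReal_iff hγ).1 h1
  · have hz := h (m + 1) (by linarith)
    have h3 : 0 ≤ cauchyMean μ X (m + 1) := by
      refine integral_nonneg_of_ae ?_
      filter_upwards [hm] with x hx
      exact inv_nonneg.2 (by linarith)
    linarith

theorem integrable_log_sub_of_cauchyMean_lt (hX : Measurable X) (hL : ∀ᵐ x ∂μ, L ≤ X x)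
    (hm : ∀ᵐ x ∂μ, X x ≤ m) (h : ∀ z, m < z → cauchyMean μ X z < γ) :
    Integrable (fun x => Real.log (m - X x)) μ := by
  refine Integrable.mono' ((integrable_inv_sub_of_cauchyMean_lt hX hm h).1.add
    (integrable_const (m - L))) (Real.measurable_log.comp (by fun_prop)).aestronglyMeasurable ?_
  filter_upwards [ae_lt_of_cauchyMean_lt hX hm h, hL] with x hx hx'
  have hpos : 0 < m - X x := by linarith
  have h1 := Real.log_le_sub_one_of_pos hpos
  have h2 := Real.log_le_sub_one_of_pos (inv_pos.2 hpos)
  rw [Real.log_inv] at h2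
  have h3 := inv_pos.2 hpos
  rw [Real.norm_eq_abs, abs_le, Pi.add_apply]
  constructor <;> linarith

/-- The tangent of the logarithm at m - X has slope (m - X)⁻¹, whose mean is at most γ. -/
theorem integral_log_sub_le (hX : Measurable X) (hL : ∀ᵐ x ∂μ, L ≤ X x)
    (hm : ∀ᵐ x ∂μ, X x ≤ m) (h : ∀ z, m < z → cauchyMean μ X z < γ) {κ : ℝ} (hκ : m < κ) :
    ∫ x, Real.log (κ - X x) ∂μ ≤ ∫ x, Real.log (m - X x) ∂μ + γ * (κ - m) := by
  obtain ⟨hi, hiγ⟩ := integrable_inv_sub_of_cauchyMean_lt hX hm h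
  have hl := integrable_log_sub_of_cauchyMean_lt hX hL hm h
  have h1 : ∫ x, Real.log (κ - X x) ∂μ ≤
      ∫ x, (Real.log (m - X x) + (m - X x)⁻¹ * (κ - m)) ∂μ := by
    refine integral_mono_ae (integrable_log_sub hX hL hm hκ) (hl.add (hi.mul_const _)) ?_
    filter_upwards [ae_lt_of_cauchyMean_lt hX hm h] with x hx
    have hpos : 0 < m - X x := by linarith
    have hpos' : 0 < κ - X x := by linarith
    have h2 := Real.log_le_sub_one_of_pos (div_pos hpos' hpos)
    rw [Real.log_div hpos'.ne' hpos.ne'] at h2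
    have h3 : (κ - X x) / (m - X x) - 1 = (m - X x)⁻¹ * (κ - m) := by field_simp; ring
    linarith
  rw [integral_add hl (hi.mul_const _), integral_mul_const] at h1
  have := mul_le_mul_of_nonneg_right hiγ (by linarith : 0 ≤ κ - m)
  linarith

theorem le_integral_log_sub (hX : Measurable X) (hL : ∀ᵐ x ∂μ, L ≤ X x)
    (hm : ∀ᵐ x ∂μ, X x ≤ m) (h : ∀ z, m < z → cauchyMean μ X z < γ) {κ : ℝ} (hκ : m < κ) :
    ∫ x, Real.log (m - X x) ∂μ ≤ ∫ x, Real.log (κ - X x) ∂μ := by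
  refine integral_mono_ae (integrable_log_sub_of_cauchyMean_lt hX hL hm h)
    (integrable_log_sub hX hL hm hκ) ?_
  filter_upwards [ae_lt_of_cauchyMean_lt hX hm h] with x hx
  exact Real.log_le_log (by linarith) (by linarith)

end Critical

end CauchyMean

/-! ### Consequences of weak convergence of the empirical measures -/

section EmpiricalMeans

open BoundedContinuousFunction

variable {μ : Measure ℝ} {X : ℝ → ℝ} {L m : ℝ} {l : ∀ N, Fin N → ℝ}

/-- Clamping the argument to [a, b] turns g into a bounded continuous test function without changing
the values that matter. -/
theorem tendsto_mean_of_continuousOn {a b : ℝ} (hab : a ≤ b)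
    (hconv : ∀ f : ℝ →ᵇ ℝ, Tendsto (fun N : ℕ => 1 / (N : ℝ) * ∑ i, f (l N i)) atTop
      (𝓝 (∫ x, f (X x) ∂μ)))
    (ha : ∀ᵐ x ∂μ, a ≤ X x) (hb : ∀ᵐ x ∂μ, X x ≤ b)
    (hl : ∀ᶠ N in atTop, ∀ i, a ≤ l N i ∧ l N i ≤ b) {g : ℝ → ℝ}
    (hg : ContinuousOn g (Set.Icc a b)) :
    Tendsto (fun N : ℕ => 1 / (N : ℝ) * ∑ i, g (l N i)) atTop (𝓝 (∫ x, g (X x) ∂μ)) := by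
  have hproj : ∀ y, a ≤ y → y ≤ b → max a (min b y) = y := fun y h1 h2 => by
    rw [min_eq_right h2, max_eq_right h1]
  have hmem : ∀ y, max a (min b y) ∈ Set.Icc a b := fun y =>
    ⟨le_max_left _ _, max_le hab (min_le_left _ _)⟩
  obtain ⟨C, hC⟩ := isCompact_Icc.exists_bound_of_continuousOn hg
  set f : ℝ →ᵇ ℝ := BoundedContinuousFunction.ofNormedAddCommGroup
    (fun y => g (max a (min b y)))
    (hg.comp_continuous (by fun_prop) hmem) C (fun y => hC _ (hmem y)) with hf
  have hfy : ∀ y, f y = g (max a (min b y)) := fun y => rfl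
  have h := hconv f
  have hint : ∫ x, f (X x) ∂μ = ∫ x, g (X x) ∂μ := by
    refine integral_congr_ae ?_
    filter_upwards [ha, hb] with x h1 h2
    rw [hfy, hproj _ h1 h2]
  rw [hint] at h
  refine h.congr' ?_
  filter_upwards [hl] with N hN
  congr 1
  exact Finset.sum_congr rfl fun i _ => by rw [hfy, hproj _ (hN i).1 (hN i).2]

theorem ae_le_of_tendsto_mean [IsProbabilityMeasure μ] (hX : Measurable X)
    (hconv : ∀ f : ℝ →ᵇ ℝ, Tendsto (fun N : ℕ => 1 / (N : ℝ) * ∑ i, f (l N i)) atTop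
      (𝓝 (∫ x, f (X x) ∂μ)))
    (hmax : ∀ δ > 0, ∀ᶠ N in atTop, ∀ i, l N i ≤ m + δ) : ∀ᵐ x ∂μ, X x ≤ m := by
  set f : ℝ →ᵇ ℝ := BoundedContinuousFunction.ofNormedAddCommGroup
    (fun y => min 1 (max 0 (y - m))) (by fun_prop) 1 (fun y => by
      rw [Real.norm_of_nonneg (le_min zero_le_one (le_max_left _ _))]
      exact min_le_left _ _) with hf
  have hfy : ∀ y, f y = min 1 (max 0 (y - m)) := fun y => rfl
  have hf0 : ∀ y, 0 ≤ f y := fun y => le_min zero_le_one (le_max_left _ _)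
  have hzero : ∫ x, f (X x) ∂μ = 0 := by
    refine le_antisymm (le_of_forall_pos_le_add fun δ hδ => ?_) (integral_nonneg fun x => hf0 _)
    rw [zero_add]
    refine le_of_tendsto (hconv f) ?_
    filter_upwards [hmax δ hδ, eventually_gt_atTop 0] with N hN hN0
    have hNpos : (0 : ℝ) < N := by exact_mod_cast hN0
    have : ∑ i, f (l N i) ≤ ∑ _i : Fin N, δ := Finset.sum_le_sum fun i _ => by
      rw [hfy]
      exact (min_le_right _ _).trans (max_le hδ.le (by linarith [hN i]))
    rw [Finset.sum_const, Finset.card_univ, Fintype.card_fin, nsmul_eq_mul] at this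
    rw [one_div, inv_mul_le_iff₀ hNpos]
    exact this
  have hint : Integrable (fun x => f (X x)) μ :=
    Integrable.of_bound (C := ‖f‖) (f.continuous.measurable.comp hX).aestronglyMeasurable
      (Eventually.of_forall fun x => f.norm_coe_le_norm _)
  have h0 := (integral_eq_zero_iff_of_nonneg (fun x => hf0 _) hint).1 hzero
  filter_upwards [h0] with x hx
  by_contra! hlt
  have : 0 < f (X x) := by
    rw [hfy]
    exact lt_min one_pos (lt_max_of_lt_right (by linarith))
  exact this.ne' hx

theorem ae_ge_of_tendsto_mean [IsProbabilityMeasure μ] (hX : Measurable X)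
    (hconv : ∀ f : ℝ →ᵇ ℝ, Tendsto (fun N : ℕ => 1 / (N : ℝ) * ∑ i, f (l N i)) atTop
      (𝓝 (∫ x, f (X x) ∂μ)))
    (hmin : ∀ δ > 0, ∀ᶠ N in atTop, ∀ i, L - δ ≤ l N i) : ∀ᵐ x ∂μ, L ≤ X x := by
  have h := ae_le_of_tendsto_mean (μ := μ) (X := fun x => -X x) (m := -L)
    (l := fun N i => -l N i) hX.neg
    (fun f => by simpa using hconv (f.compContinuous ⟨fun y => -y, continuous_neg⟩)) (by
      intro δ hδ
      filter_upwards [hmin δ hδ] with N hN i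
      linarith [hN i])
  filter_upwards [h] with x hx
  linarith

end EmpiricalMeans

/-! ### Saddle points and the limit for positive γ -/

section Core

open BoundedContinuousFunction

variable {μ : Measure ℝ} [IsProbabilityMeasure μ] {X : ℝ → ℝ} {L m γ κ : ℝ}

/-- `κ` is the point where the mean of `(κ - X)⁻¹` equals `γ`, or the endpoint `m` when this mean
stays below `γ` beyond `m`. -/
def IsSaddlePoint (μ : Measure ℝ) (X : ℝ → ℝ) (m γ κ : ℝ) : Prop :=
  (m < κ ∧ cauchyMean μ X κ = γ) ∨ (κ = m ∧ ∀ z, m < z → cauchyMean μ X z < γ)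

theorem IsSaddlePoint.ae_lt (hκ : IsSaddlePoint μ X m γ κ) (hX : Measurable X)
    (hm : ∀ᵐ x ∂μ, X x ≤ m) : ∀ᵐ x ∂μ, X x < κ := by
  rcases hκ with ⟨h, -⟩ | ⟨rfl, h⟩
  · filter_upwards [hm] with x hx using hx.trans_lt h
  · exact ae_lt_of_cauchyMean_lt hX hm h

theorem IsSaddlePoint.integrable_log (hκ : IsSaddlePoint μ X m γ κ) (hX : Measurable X)
    (hL : ∀ᵐ x ∂μ, L ≤ X x) (hm : ∀ᵐ x ∂μ, X x ≤ m) :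
    Integrable (fun x => Real.log (κ - X x)) μ := by
  rcases hκ with ⟨h, -⟩ | ⟨rfl, h⟩
  · exact integrable_log_sub hX hL hm h
  · exact integrable_log_sub_of_cauchyMean_lt hX hL hm h

/-- The finite N bounds need z strictly beyond m. An interior saddle point serves itself; at the
endpoint, z = m + ε/γ keeps both the change of the potential and the loss (γ - h)(z - m) below ε. -/
theorem IsSaddlePoint.exists_approx (hκ : IsSaddlePoint μ X m γ κ) (hX : Measurable X)
    (hL : ∀ᵐ x ∂μ, L ≤ X x) (hm : ∀ᵐ x ∂μ, X x ≤ m) (hγ : 0 < γ) {ε : ℝ} (hε : 0 < ε) :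
    ∃ z, m < z ∧ cauchyMean μ X z ≤ γ ∧
      γ * z - ∫ x, Real.log (z - X x) ∂μ ≤ γ * κ - ∫ x, Real.log (κ - X x) ∂μ + ε ∧
      γ * κ - ∫ x, Real.log (κ - X x) ∂μ - ε ≤
        γ * z - ∫ x, Real.log (z - X x) ∂μ - (γ - cauchyMean μ X z) * (z - m) := by
  rcases hκ with ⟨h, h'⟩ | ⟨rfl, h⟩
  · refine ⟨κ, h, h'.le, by linarith, ?_⟩
    rw [h', sub_self, zero_mul]
    linarith
  · have hz : κ < κ + ε / γ := by linarith [div_pos hε hγ]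
    refine ⟨κ + ε / γ, hz, (h _ hz).le, ?_, ?_⟩
    · have h1 := le_integral_log_sub hX hL hm h hz
      have h2 : γ * (κ + ε / γ) = γ * κ + ε := by field_simp
      linarith
    · have h1 := integral_log_sub_le hX hL hm h hz
      have h2 : γ * (κ + ε / γ - κ) = ε := by field_simp; ring
      have h3 := mul_pos (cauchyMean_pos hX hL hm hz) (by linarith : 0 < κ + ε / γ - κ)
      have h4 : γ * (κ + ε / γ) = γ * κ + ε := by field_simp
      linarith

theorem tendsto_log_expMean (𝕜 : Type*) [RCLike 𝕜] {l : ∀ N, Fin N → ℝ} (hX : Measurable X)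
    (hconv : ∀ f : ℝ →ᵇ ℝ, Tendsto (fun N : ℕ => 1 / (N : ℝ) * ∑ i, f (l N i)) atTop
      (𝓝 (∫ x, f (X x) ∂μ)))
    (hmin : ∀ δ > 0, ∀ᶠ N in atTop, ∀ i, L - δ ≤ l N i)
    (hmax : ∀ δ > 0, ∀ᶠ N in atTop, ∀ i, l N i ≤ m + δ)
    (htop : ∀ δ > 0, ∀ᶠ N in atTop, ∃ i, m - δ ≤ l N i) (hγ : 0 < γ)
    (hκ : IsSaddlePoint μ X m γ κ) {F : ℕ → ℝ}
    (hF : ∀ᶠ N in atTop, ∃ j : Fin N, F N = 1 / (N : ℝ) *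
      Real.log (expMean 𝕜 (l N) ((Module.finrank ℝ 𝕜 : ℝ) / 2 * γ) j)) :
    Tendsto F atTop (𝓝 ((Module.finrank ℝ 𝕜 : ℝ) / 2 *
      (γ * κ - 1 - Real.log γ - ∫ x, Real.log (κ - X x) ∂μ))) := by
  set d := (Module.finrank ℝ 𝕜 : ℝ) with hd
  have hd0 : 0 < d := finrank_real_pos 𝕜
  have hm := ae_le_of_tendsto_mean hX hconv hmax
  have hL := ae_ge_of_tendsto_mean hX hconv hmin
  have hLm := le_of_ae_bounds hL hm
  rw [Metric.tendsto_atTop']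
  suffices H : ∀ ε > 0, ∀ᶠ N in atTop, |F N - d / 2 * (γ * κ - 1 - Real.log γ -
      ∫ x, Real.log (κ - X x) ∂μ)| ≤ ε by
    intro ε hε
    obtain ⟨n, hn⟩ := eventually_atTop.1 (H (ε / 2) (by linarith))
    refine ⟨n, fun N hN => ?_⟩
    rw [Real.dist_eq]
    linarith [hn N hN.le]
  intro ε hε
  set ε' := ε / (d + 1) with hε'
  have hε'0 : 0 < ε' := by positivity
  have hε'd : d * ε' + ε' = ε := by rw [hε']; field_simp
  obtain ⟨z, hz, hzγ, hup, hlo⟩ := hκ.exists_approx hX hL hm hγ hε'0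
  have hδ : 0 < (z - m) / 2 := by linarith
  have hbound : ∀ᶠ N in atTop, ∀ i, L - 1 ≤ l N i ∧ l N i ≤ m + (z - m) / 2 := by
    filter_upwards [hmin 1 one_pos, hmax _ hδ] with N h1 h2 i using ⟨h1 i, h2 i⟩
  have hne : ∀ y ∈ Set.Icc (L - 1) (m + (z - m) / 2), z - y ≠ 0 := fun y hy => by
    have := hy.2
    intro h0
    linarith
  have hLb : ∀ᵐ x ∂μ, L - 1 ≤ X x := by filter_upwards [hL] with x hx; linarith
  have hmb : ∀ᵐ x ∂μ, X x ≤ m + (z - m) / 2 := by filter_upwards [hm] with x hx; linarith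
  have hinv := tendsto_mean_of_continuousOn (by linarith) hconv hLb hmb hbound
    (g := fun y => (z - y)⁻¹) (ContinuousOn.inv₀ (by fun_prop) hne)
  have hlog := tendsto_mean_of_continuousOn (by linarith) hconv hLb hmb hbound
    (g := fun y => Real.log (z - y)) (ContinuousOn.log (by fun_prop) hne)
  have hlower := eventually_le_log_expMean (𝕜 := 𝕜) hγ hz hmax htop hinv hzγ
    (by linarith : 0 < ε' / 2)
  have hld : 0 < ε' / (2 * d) := by positivity
  filter_upwards [hF, hbound, hlower, Metric.tendsto_nhds.1 hlog _ hε'0,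
    eventually_gt_atTop 0] with N hFN hb hlow hlogN hN0
  have hN : (0 : ℝ) < N := by exact_mod_cast hN0
  obtain ⟨j, hj⟩ := hFN
  have hupper := log_expMean_le (𝕜 := 𝕜) (l := l N) (κ := z) (fun i => by linarith [(hb i).2]) hγ j
  have hupper' := mul_le_mul_of_nonneg_left hupper (by positivity : (0 : ℝ) ≤ 1 / N)
  have hexp : 1 / (N : ℝ) * (d / 2 * (N * (γ * z - 1 - Real.log γ) - ∑ i, Real.log (z - l N i))) =
      d / 2 * (γ * z - 1 - Real.log γ - 1 / (N : ℝ) * ∑ i, Real.log (z - l N i)) := by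
    field_simp
  rw [← hd, hexp, ← hj] at hupper'
  have hlow' := hlow j
  rw [← hj] at hlow'
  rw [Real.dist_eq, abs_lt] at hlogN
  have hlo' : γ * κ - ∫ x, Real.log (κ - X x) ∂μ - ε' ≤
        γ * z - ∫ x, Real.log (z - X x) ∂μ - (γ - ∫ x, (z - X x)⁻¹ ∂μ) * (z - m) := hlo
  have g1 := mul_le_mul_of_nonneg_left hup (by positivity : 0 ≤ d / 2)
  have g2 := mul_le_mul_of_nonneg_left hlo' (by positivity : 0 ≤ d / 2)
  have g3 := mul_le_mul_of_nonneg_left hlogN.1.le (by positivity : 0 ≤ d / 2)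
  have g4 := mul_le_mul_of_nonneg_left hlogN.2.le (by positivity : 0 ≤ d / 2)
  rw [abs_le]
  constructor <;> linarith

theorem IsSaddlePoint.conclusion (𝕜 : Type*) [RCLike 𝕜] {l : ∀ N, Fin N → ℝ} (hX : Measurable X)
    (hconv : ∀ f : ℝ →ᵇ ℝ, Tendsto (fun N : ℕ => 1 / (N : ℝ) * ∑ i, f (l N i)) atTop
      (𝓝 (∫ x, f (X x) ∂μ)))
    (hmin : ∀ δ > 0, ∀ᶠ N in atTop, ∀ i, L - δ ≤ l N i)
    (hmax : ∀ δ > 0, ∀ᶠ N in atTop, ∀ i, l N i ≤ m + δ)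
    (htop : ∀ δ > 0, ∀ᶠ N in atTop, ∃ i, m - δ ≤ l N i) (hγ : 0 < γ)
    (hκ : IsSaddlePoint μ X m γ κ) {F : ℕ → ℝ}
    (hF : ∀ᶠ N in atTop, ∃ j : Fin N, F N = 1 / (N : ℝ) *
      Real.log (expMean 𝕜 (l N) ((Module.finrank ℝ 𝕜 : ℝ) / 2 * γ) j)) :
    (∀ᵐ x ∂μ, 0 < γ * (κ - X x)) ∧ Integrable (fun x => Real.log (γ * (κ - X x))) μ ∧
    Tendsto F atTop (𝓝 ((Module.finrank ℝ 𝕜 : ℝ) / 2 * (γ * κ - 1) -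
      (Module.finrank ℝ 𝕜 : ℝ) / 2 * ∫ x, Real.log (γ * (κ - X x)) ∂μ)) := by
  have hm := ae_le_of_tendsto_mean hX hconv hmax
  have hL := ae_ge_of_tendsto_mean hX hconv hmin
  have hlt := hκ.ae_lt hX hm
  have hint := hκ.integrable_log hX hL hm
  have hlog : (fun x => Real.log (γ * (κ - X x))) =ᵐ[μ]
      fun x => Real.log γ + Real.log (κ - X x) := by
    filter_upwards [hlt] with x hx
    rw [Real.log_mul hγ.ne' (by linarith)]
  refine ⟨?_, ((integrable_const _).add hint).congr hlog.symm, ?_⟩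
  · filter_upwards [hlt] with x hx using mul_pos hγ (by linarith)
  · convert tendsto_log_expMean 𝕜 hX hconv hmin hmax htop hγ hκ hF using 2
    rw [integral_congr_ae hlog, integral_add (integrable_const _) hint]
    simp
    ring

/-- The location of the saddle point within the interval `(b, ∞)` on which the mean of
`(z - X)⁻¹` is defined and decreasing. -/
theorem exists_isSaddlePoint_of_le_sSup {b : ℝ} (hX : Measurable X) (hL : ∀ᵐ x ∂μ, L ≤ X x)
    (hb : ∀ᵐ x ∂μ, X x ≤ b) (hbm : b ≤ m) (hγ : 0 < γ)
    (h : (γ : EReal) ≤ sSup ((fun z => (cauchyMean μ X z : EReal)) '' Set.Ioi m)) :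
    ∃ κ, IsSaddlePoint μ X m γ κ ∧ b ≤ κ ∧ (∀ z, b < z → κ < z → cauchyMean μ X z < γ) ∧
      (∀ z, b < z → z < κ → γ < cauchyMean μ X z) ∧
      γ ∈ closure (cauchyMean μ X '' Set.Ioi b) := by
  have hm : ∀ᵐ x ∂μ, X x ≤ m := by filter_upwards [hb] with x hx using hx.trans hbm
  have hanti := strictAntiOn_cauchyMean hX hL hb
  rcases h.lt_or_eq with hlt | heq
  · obtain ⟨κ, hκ, hκγ⟩ := exists_cauchyMean_eq hX hL hm hγ hlt
    have hbκ : b < κ := hbm.trans_lt hκ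
    refine ⟨κ, Or.inl ⟨hκ, hκγ⟩, hbκ.le, fun z hz hκz => ?_, fun z hz hκz => ?_,
      subset_closure ⟨κ, hbκ, hκγ⟩⟩
    · exact hκγ ▸ hanti hbκ hz hκz
    · exact hκγ ▸ hanti hz hbκ hκz
  -- At the critical value γ is the limit of the Cauchy mean at m, whether or not it is attained;
  -- the saddle point is m itself.
  · have hlt := fun z => cauchyMean_lt_of_sSup_le hX hL hm heq.ge (z := z)
    have hlim : Tendsto (cauchyMean μ X) (𝓝[>] m) (𝓝 γ) := by
      have := tendsto_cauchyMean_nhdsGT hX hL hm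
      rw [← heq] at this
      exact EReal.tendsto_coe.1 this
    refine ⟨m, Or.inr ⟨rfl, hlt⟩, hbm, fun z _ hz => hlt z hz, fun z hz hzm => ?_, ?_⟩
    · have hmid : b < (z + m) / 2 := by linarith
      refine lt_of_le_of_lt (le_of_tendsto hlim ?_) (hanti hz hmid (by linarith))
      filter_upwards [self_mem_nhdsWithin] with w hw
      rw [Set.mem_Ioi] at hw
      exact (hanti hmid (show b < w by linarith) (by linarith)).le
    · refine mem_closure_of_tendsto hlim ?_
      filter_upwards [self_mem_nhdsWithin] with w hw
      exact ⟨w, hbm.trans_lt hw, rfl⟩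

end Core

/-! ### Identification of the R-transform -/

section RTransform

variable {μ : Measure ℝ} {γ κ : ℝ}

/-- Values near γ ≠ 0 have the sign of γ, so their preimages lie in S, where the transform is
strictly decreasing. Comparison with points of S close to κ makes the inverse tend to κ, even if γ
is only a limit of values. -/
theorem rTransform_eq {S : Set ℝ} (hSA : S ⊆ outside μ) (hS : S.OrdConnected)
    (hanti : StrictAntiOn (hilbertTransform μ) S)
    (hinj : Set.InjOn (hilbertTransform μ) (outside μ)) (hκ : κ ∈ closure S) (hγ : γ ≠ 0)
    (hsep : ∀ z ∈ outside μ, z ∉ S → hilbertTransform μ z * γ ≤ 0)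
    (hgt : ∀ z ∈ S, κ < z → hilbertTransform μ z < γ)
    (hlt : ∀ z ∈ S, z < κ → γ < hilbertTransform μ z)
    (hcl : γ ∈ closure (hilbertTransform μ '' S)) : rTransform μ γ = κ - γ⁻¹ := by
  refine extendFrom_eq (closure_mono (Set.image_mono hSA) hcl) (Tendsto.sub ?_
    ((tendsto_inv₀ hγ).mono_left nhdsWithin_le_nhds))
  have hKz : ∀ z ∈ outside μ, inverseHilbert μ (hilbertTransform μ z) = z := fun z hz =>
    hinj.leftInvOn_invFunOn hz
  have hsign : ∀ᶠ y in 𝓝[hilbertTransform μ '' outside μ] γ, 0 < y * γ := by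
    have h1 : Tendsto (fun y : ℝ => y * γ) (𝓝 γ) (𝓝 (γ * γ)) := tendsto_id.mul_const γ
    exact (h1.mono_left nhdsWithin_le_nhds).eventually_const_lt (mul_self_pos.2 hγ)
  have hev : ∀ P : ℝ → ℝ → Prop, (∀ᶠ y in 𝓝 γ, ∀ z ∈ S, hilbertTransform μ z = y → P z y) →
      ∀ᶠ y in 𝓝[hilbertTransform μ '' outside μ] γ, P (inverseHilbert μ y) y := by
    intro P hP
    filter_upwards [hsign, mem_nhdsWithin_of_mem_nhds hP, self_mem_nhdsWithin] with y h1 h2 h3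
    obtain ⟨z, hz, rfl⟩ := h3
    rw [hKz z hz]
    refine h2 z ?_ rfl
    by_contra hzS
    exact absurd (hsep z hz hzS) (not_le.2 h1)
  rw [tendsto_order]
  constructor
  · intro c hc
    refine hev (fun z _ => c < z) ?_
    by_cases hex : ∃ z₁ ∈ S, z₁ ≤ c
    · obtain ⟨z₁, hz₁, hz₁c⟩ := hex
      obtain ⟨s, hs, hsS⟩ := mem_closure_iff_nhds.1 hκ _ (lt_mem_nhds hc)
      have hpS : min s ((κ + c) / 2) ∈ S := hS.out hz₁ hsS
        ⟨le_min (hz₁c.trans (le_of_lt hs)) (by linarith), min_le_left _ _⟩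
      have hpκ : min s ((κ + c) / 2) < κ := (min_le_right _ _).trans_lt (by linarith)
      have hcp : c < min s ((κ + c) / 2) := lt_min hs (by linarith)
      filter_upwards [gt_mem_nhds (hlt _ hpS hpκ)] with y hy z hz hzy
      by_contra! hle
      have := hanti hz hpS (hle.trans_lt hcp)
      linarith
    · push Not at hex
      exact Eventually.of_forall fun y z hz _ => hex z hz
  · intro c hc
    refine hev (fun z _ => z < c) ?_
    by_cases hex : ∃ z₁ ∈ S, c ≤ z₁
    · obtain ⟨z₁, hz₁, hz₁c⟩ := hex
      obtain ⟨s, hs, hsS⟩ := mem_closure_iff_nhds.1 hκ _ (gt_mem_nhds hc)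
      have hpS : max s ((κ + c) / 2) ∈ S := hS.out hsS hz₁
        ⟨le_max_left _ _, max_le ((le_of_lt hs).trans hz₁c) (by linarith)⟩
      have hpκ : κ < max s ((κ + c) / 2) := lt_of_lt_of_le (by linarith) (le_max_right _ _)
      have hcp : max s ((κ + c) / 2) < c := max_lt hs (by linarith)
      filter_upwards [lt_mem_nhds (hgt _ hpS hpκ)] with y hy z hz hzy
      by_contra! hle
      have := hanti hpS hz (hcp.trans_le hle)
      linarith
    · push Not at hex
      exact Eventually.of_forall fun y z hz _ => hex z hz

theorem hilbertTransform_eq_neg_cauchyMean (μ : Measure ℝ) (z : ℝ) :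
    hilbertTransform μ z = -cauchyMean μ (fun x => -x) (-z) := by
  unfold hilbertTransform cauchyMean
  rw [← integral_neg]
  refine integral_congr_ae (Eventually.of_forall fun x => ?_)
  dsimp only
  rw [← inv_neg]
  congr 1
  ring

end RTransform

/-! ### The two half-lines outside the convex hull of the support -/

section Support

variable {μ : Measure ℝ} [IsProbabilityMeasure μ] {γ κ : ℝ}

theorem exists_outside_eq (hμ : IsCompact μ.support) :
    ∃ a b : ℝ, a ∈ μ.support ∧ b ∈ μ.support ∧ outside μ = Set.Iio a ∪ Set.Ioi b ∧
      (∀ᵐ x ∂μ, a ≤ x) ∧ ∀ᵐ x ∂μ, x ≤ b := by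
  have hne : μ.support.Nonempty := Measure.nonempty_support (IsProbabilityMeasure.ne_zero μ)
  obtain ⟨a, ha, ha'⟩ := hμ.exists_isLeast hne
  obtain ⟨b, hb, hb'⟩ := hμ.exists_isGreatest hne
  refine ⟨a, b, ha, hb, ?_, ?_, ?_⟩
  · have : convexHull ℝ μ.support = Set.Icc a b := by
      refine Set.Subset.antisymm (convexHull_min (fun x hx => ⟨ha' hx, hb' hx⟩)
        (convex_Icc a b)) ?_
      exact (convex_convexHull ℝ _).ordConnected.out (subset_convexHull ℝ _ ha)
        (subset_convexHull ℝ _ hb)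
    ext x
    simp only [outside, this, Set.mem_compl_iff, Set.mem_Icc, Set.mem_union, Set.mem_Iio,
      Set.mem_Ioi, not_and_or, not_le]
  · filter_upwards [Measure.support_mem_ae (μ := μ)] with x hx using ha' hx
  · filter_upwards [Measure.support_mem_ae (μ := μ)] with x hx using hb' hx

theorem injOn_hilbertTransform {a b : ℝ} (ha : ∀ᵐ x ∂μ, a ≤ x) (hb : ∀ᵐ x ∂μ, x ≤ b) :
    (∀ z ∈ Set.Iio a, hilbertTransform μ z < 0) ∧ (∀ z ∈ Set.Ioi b, 0 < hilbertTransform μ z) ∧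
    StrictAntiOn (hilbertTransform μ) (Set.Iio a) ∧
    StrictAntiOn (hilbertTransform μ) (Set.Ioi b) ∧
    Set.InjOn (hilbertTransform μ) (Set.Iio a ∪ Set.Ioi b) := by
  have ha' : ∀ᵐ x ∂μ, -x ≤ -a := by filter_upwards [ha] with x hx using neg_le_neg hx
  have hb' : ∀ᵐ x ∂μ, -b ≤ -x := by filter_upwards [hb] with x hx using neg_le_neg hx
  have hneg : ∀ z ∈ Set.Iio a, hilbertTransform μ z < 0 := fun z hz => by
    rw [hilbertTransform_eq_neg_cauchyMean]
    exact neg_neg_of_pos (cauchyMean_pos measurable_neg hb' ha' (neg_lt_neg hz))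
  have hpos : ∀ z ∈ Set.Ioi b, 0 < hilbertTransform μ z := fun z hz =>
    cauchyMean_pos measurable_id ha hb hz
  have hanti : StrictAntiOn (hilbertTransform μ) (Set.Iio a) := fun z hz w hw hzw => by
    rw [hilbertTransform_eq_neg_cauchyMean, hilbertTransform_eq_neg_cauchyMean]
    exact neg_lt_neg (strictAntiOn_cauchyMean measurable_neg hb' ha'
      (show -a < -w from neg_lt_neg hw) (show -a < -z from neg_lt_neg hz) (neg_lt_neg hzw))
  have hanti' : StrictAntiOn (hilbertTransform μ) (Set.Ioi b) :=
    strictAntiOn_cauchyMean measurable_id ha hb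
  refine ⟨hneg, hpos, hanti, hanti', ?_⟩
  rintro z (hz | hz) w (hw | hw) hzw
  · exact hanti.injOn hz hw hzw
  · exact absurd hzw ((hneg z hz).trans (hpos w hw)).ne
  · exact absurd hzw ((hneg w hw).trans (hpos z hz)).ne'
  · exact hanti'.injOn hz hw hzw

theorem exists_rTransform_eq_right (hμ : IsCompact μ.support) {m : ℝ} (hm : ∀ᵐ x ∂μ, x ≤ m)
    (hγ : 0 < γ)
    (h : (γ : EReal) ≤ sSup ((fun z => (cauchyMean μ (fun x => x) z : EReal)) '' Set.Ioi m)) :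
    ∃ κ, IsSaddlePoint μ (fun x => x) m γ κ ∧ rTransform μ γ = κ - γ⁻¹ := by
  obtain ⟨a, b, -, hbs, hout, ha, hb⟩ := exists_outside_eq hμ
  obtain ⟨hneg, -, -, hanti, hinj⟩ := injOn_hilbertTransform ha hb
  have hbm : b ≤ m := Measure.support_subset_of_isClosed isClosed_Iic hm hbs
  obtain ⟨κ, hκ, hbκ, hgt, hlt, hcl⟩ :=
    exists_isSaddlePoint_of_le_sSup measurable_id ha hb hbm hγ h
  refine ⟨κ, hκ, rTransform_eq (S := Set.Ioi b) (hout ▸ Set.subset_union_right)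
    Set.ordConnected_Ioi hanti (hout ▸ hinj) (by rw [closure_Ioi]; exact hbκ) hγ.ne'
    (fun z hz hzS => ?_) (fun z hz => hgt z hz) (fun z hz => hlt z hz) hcl⟩
  rw [hout] at hz
  exact mul_nonpos_of_nonpos_of_nonneg (hneg z (hz.resolve_right hzS)).le hγ.le

theorem exists_rTransform_eq_left (hμ : IsCompact μ.support) {m : ℝ} (hm : ∀ᵐ x ∂μ, -x ≤ m)
    (hγ : 0 < γ)
    (h : (γ : EReal) ≤ sSup ((fun z => (cauchyMean μ (fun x => -x) z : EReal)) '' Set.Ioi m)) :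
    ∃ κ, IsSaddlePoint μ (fun x => -x) m γ κ ∧ rTransform μ (-γ) = -κ - (-γ)⁻¹ := by
  obtain ⟨a, b, has, -, hout, ha, hb⟩ := exists_outside_eq hμ
  obtain ⟨-, hpos, hanti, -, hinj⟩ := injOn_hilbertTransform ha hb
  have ha' : ∀ᵐ x ∂μ, -x ≤ -a := by filter_upwards [ha] with x hx using neg_le_neg hx
  have hb' : ∀ᵐ x ∂μ, -b ≤ -x := by filter_upwards [hb] with x hx using neg_le_neg hx
  have ham : -a ≤ m := Measure.support_subset_of_isClosed (t := {x : ℝ | -x ≤ m})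
    (isClosed_le continuous_neg continuous_const) hm has
  obtain ⟨κ, hκ, hbκ, hgt, hlt, hcl⟩ :=
    exists_isSaddlePoint_of_le_sSup measurable_neg hb' ha' ham hγ h
  refine ⟨κ, hκ, rTransform_eq (S := Set.Iio a) (hout ▸ Set.subset_union_left)
    Set.ordConnected_Iio hanti (hout ▸ hinj)
    (by rw [closure_Iio, Set.mem_Iic]; linarith) (neg_ne_zero.2 hγ.ne')
    (fun z hz hzS => ?_) (fun z hz hκz => ?_) (fun z hz hκz => ?_) ?_⟩
  · rw [hout] at hz
    exact mul_nonpos_of_nonneg_of_nonpos (hpos z (hz.resolve_left hzS)).le (by linarith)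
  · rw [hilbertTransform_eq_neg_cauchyMean]
    exact neg_lt_neg (hlt _ (neg_lt_neg hz) (by linarith))
  · rw [hilbertTransform_eq_neg_cauchyMean]
    exact neg_lt_neg (hgt _ (neg_lt_neg hz) (by linarith))
  · refine map_mem_closure continuous_neg hcl ?_
    rintro _ ⟨z, hz, rfl⟩
    refine ⟨-z, show -z < a from neg_lt.1 hz, ?_⟩
    rw [hilbertTransform_eq_neg_cauchyMean, neg_neg]

end Support

/-! ### Integrals against the spectral measure -/

section SpectralMeasure

open BoundedContinuousFunction

variable {𝕜 : Type*} [RCLike 𝕜]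

theorem integral_spectralMeasure {N : ℕ} {E : Matrix (Fin N) (Fin N) 𝕜} (hE : E.IsHermitian)
    (f : ℝ →ᵇ ℝ) : ∫ x, f x ∂(spectralMeasure hE : Measure ℝ) =
      1 / (N : ℝ) * ∑ i, f (hE.eigenvalues i) := by
  unfold spectralMeasure
  rw [FiniteMeasure.toMeasure_smul, FiniteMeasure.toMeasure_sum, integral_smul_nnreal_measure,
    integral_finsetSum_measure fun i _ => f.integrable _]
  have hdirac : ∀ y : ℝ, ((diracProba y).toFiniteMeasure : Measure ℝ) = Measure.dirac y :=
    fun _ => rfl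
  simp [hdirac, NNReal.smul_def]

end SpectralMeasure

/-! ### Endpoint limits of the Hilbert transform -/

section Limits

variable {μ : Measure ℝ} [IsProbabilityMeasure μ] {L m : ℝ}

theorem sSup_cauchyMean_pos {X : ℝ → ℝ} (hX : Measurable X) (hL : ∀ᵐ x ∂μ, L ≤ X x)
    (hm : ∀ᵐ x ∂μ, X x ≤ m) :
    0 < sSup ((fun z => (cauchyMean μ X z : EReal)) '' Set.Ioi m) := by
  have hz : m < m + 1 := by linarith
  exact (EReal.coe_pos.2 (cauchyMean_pos hX hL hm hz)).trans_le
    (le_sSup (Set.mem_image_of_mem _ hz))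

theorem tendsto_hilbertTransform_nhdsLT (hL : ∀ᵐ x ∂μ, L ≤ x) (hm : ∀ᵐ x ∂μ, x ≤ m) :
    Tendsto (fun z => (hilbertTransform μ z : EReal)) (𝓝[<] L)
      (𝓝 (-sSup ((fun z => (cauchyMean μ (fun x => -x) z : EReal)) '' Set.Ioi (-L)))) := by
  have hL' : ∀ᵐ x ∂μ, -x ≤ -L := by filter_upwards [hL] with x hx using neg_le_neg hx
  have hm' : ∀ᵐ x ∂μ, -m ≤ -x := by filter_upwards [hm] with x hx using neg_le_neg hx
  have h := (tendsto_cauchyMean_nhdsGT measurable_neg hm' hL').comp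
    (tendsto_neg_nhdsLT (a := L))
  refine (continuous_neg.continuousAt.tendsto.comp h).congr fun z => ?_
  simp [hilbertTransform_eq_neg_cauchyMean]

end Limits

/-! ### Bounds from the convergence of the extreme eigenvalues -/

section Eigenvalues

variable {𝕜 : Type*} [RCLike 𝕜] {E : ∀ N : ℕ, Matrix (Fin N) (Fin N) 𝕜}

theorem eventually_eigenvalues_le (hE : ∀ N, (E N).IsHermitian) {m : ℝ}
    (h : Tendsto (fun N => maxEigenvalue (hE N)) atTop (𝓝 m)) (δ : ℝ) (hδ : 0 < δ) :
    ∀ᶠ N in atTop, ∀ i, (hE N).eigenvalues i ≤ m + δ := by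
  filter_upwards [h.eventually_lt_const (show m < m + δ by linarith)] with N hN i
  exact (le_ciSup (Set.finite_range _).bddAbove i).trans hN.le

theorem eventually_le_eigenvalues (hE : ∀ N, (E N).IsHermitian) {m : ℝ}
    (h : Tendsto (fun N => minEigenvalue (hE N)) atTop (𝓝 m)) (δ : ℝ) (hδ : 0 < δ) :
    ∀ᶠ N in atTop, ∀ i, m - δ ≤ (hE N).eigenvalues i := by
  filter_upwards [h.eventually_const_lt (show m - δ < m by linarith)] with N hN i
  exact hN.le.trans (ciInf_le (Set.finite_range _).bddBelow i)

theorem eventually_exists_le_eigenvalues (hE : ∀ N, (E N).IsHermitian) {m : ℝ}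
    (h : Tendsto (fun N => maxEigenvalue (hE N)) atTop (𝓝 m)) (δ : ℝ) (hδ : 0 < δ) :
    ∀ᶠ N in atTop, ∃ i, m - δ ≤ (hE N).eigenvalues i := by
  filter_upwards [h.eventually_const_lt (show m - δ < m by linarith), eventually_gt_atTop 0]
    with N hN hN0
  have : Nonempty (Fin N) := ⟨⟨0, hN0⟩⟩
  obtain ⟨i, hi⟩ := exists_eq_ciSup_of_finite (f := (hE N).eigenvalues)
  exact ⟨i, hN.le.trans_eq hi.symm⟩

theorem eventually_exists_eigenvalues_le (hE : ∀ N, (E N).IsHermitian) {m : ℝ}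
    (h : Tendsto (fun N => minEigenvalue (hE N)) atTop (𝓝 m)) (δ : ℝ) (hδ : 0 < δ) :
    ∀ᶠ N in atTop, ∃ i, (hE N).eigenvalues i ≤ m + δ := by
  filter_upwards [h.eventually_lt_const (show m < m + δ by linarith), eventually_gt_atTop 0]
    with N hN hN0
  have : Nonempty (Fin N) := ⟨⟨0, hN0⟩⟩
  obtain ⟨i, hi⟩ := exists_eq_ciInf_of_finite (f := (hE N).eigenvalues)
  exact ⟨i, hi.trans_le hN.le⟩

end Eigenvalues

end SphericalIntegral

/-! ### The limit for every θ -/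

open SphericalIntegral in
theorem mainTheorem4 {𝕜 : Type*} [RCLike 𝕜]
    -- `β = 1` for real symmetric matrices (`𝕜 = ℝ`), `β = 2` for Hermitian ones (`𝕜 = ℂ`)
    (β : ℝ) (hβ : β = Module.finrank ℝ 𝕜)
    (E : ∀ N : ℕ, Matrix (Fin N) (Fin N) 𝕜) (hE : ∀ N, (E N).IsHermitian)
    (μ : ProbabilityMeasure ℝ) (hμ : IsCompact (μ : Measure ℝ).support)
    (hweak : Tendsto (fun N => spectralMeasure (hE N)) atTop (𝓝 μ.toFiniteMeasure))
    (lMin lMax : ℝ)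
    (hmin : Tendsto (fun N => minEigenvalue (hE N)) atTop (𝓝 lMin))
    (hmax : Tendsto (fun N => maxEigenvalue (hE N)) atTop (𝓝 lMax)) :
    ∃ hMin hMax : EReal,
      Tendsto (fun z => (hilbertTransform μ z : EReal)) (𝓝[<] lMin) (𝓝 hMin) ∧
      Tendsto (fun z => (hilbertTransform μ z : EReal)) (𝓝[>] lMax) (𝓝 hMax) ∧
      ∀ θ : ℝ,
        let v : ℝ := saddle β μ lMin lMax hMin hMax θ
        (∀ᵐ x ∂(μ : Measure ℝ), 0 < 1 + 2 / β * θ * v - 2 / β * θ * x) ∧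
        Integrable (fun x => Real.log (1 + 2 / β * θ * v - 2 / β * θ * x)) (μ : Measure ℝ) ∧
        Tendsto (fun N : ℕ => 1 / (N : ℝ) * Real.log (rankOneSphericalIntegral θ (E N))) atTop
          (𝓝 (θ * v -
            β / 2 * ∫ x, Real.log (1 + 2 / β * θ * v - 2 / β * θ * x) ∂(μ : Measure ℝ))) := by
  have hβ0 : 0 < β := hβ ▸ finrank_real_pos 𝕜
  have hconv : ∀ f : BoundedContinuousFunction ℝ ℝ,
      Tendsto (fun N : ℕ => 1 / (N : ℝ) * ∑ i, f ((hE N).eigenvalues i)) atTop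
        (𝓝 (∫ x, f x ∂(μ : Measure ℝ))) := fun f => by
    have h := FiniteMeasure.tendsto_iff_forall_integral_tendsto.1 hweak f
    simp only [integral_spectralMeasure] at h
    exact h
  have hconv' : ∀ f : BoundedContinuousFunction ℝ ℝ,
      Tendsto (fun N : ℕ => 1 / (N : ℝ) * ∑ i, f (-(hE N).eigenvalues i)) atTop
        (𝓝 (∫ x, f (-x) ∂(μ : Measure ℝ))) := fun f =>
    hconv (f.compContinuous ⟨fun y => -y, continuous_neg⟩)
  have hle := eventually_eigenvalues_le hE hmax
  have hge := eventually_le_eigenvalues hE hmin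
  have htop := eventually_exists_le_eigenvalues hE hmax
  have hbot := eventually_exists_eigenvalues_le hE hmin
  have hm : ∀ᵐ x ∂(μ : Measure ℝ), x ≤ lMax := ae_le_of_tendsto_mean measurable_id hconv hle
  have hL : ∀ᵐ x ∂(μ : Measure ℝ), lMin ≤ x := ae_ge_of_tendsto_mean measurable_id hconv hge
  have hm' : ∀ᵐ x ∂(μ : Measure ℝ), -lMax ≤ -x := by
    filter_upwards [hm] with x hx using neg_le_neg hx
  have hL' : ∀ᵐ x ∂(μ : Measure ℝ), -x ≤ -lMin := by
    filter_upwards [hL] with x hx using neg_le_neg hx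
  have hposR := sSup_cauchyMean_pos (X := fun x => x) measurable_id hL hm
  have hposL := sSup_cauchyMean_pos (X := fun x => -x) measurable_neg hm' hL'
  refine ⟨_, _, tendsto_hilbertTransform_nhdsLT hL hm,
    tendsto_cauchyMean_nhdsGT (X := fun x => x) measurable_id hL hm, fun θ => ?_⟩
  set hMin : EReal :=
    -sSup ((fun z => (cauchyMean (μ : Measure ℝ) (fun x => -x) z : EReal)) '' Set.Ioi (-lMin))
    with hhMin
  set hMax : EReal :=
    sSup ((fun z => (cauchyMean (μ : Measure ℝ) (fun x => x) z : EReal)) '' Set.Ioi lMax) with hhMax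
  intro v
  have hF : ∀ᶠ N in atTop, ∃ j : Fin N, 1 / (N : ℝ) * Real.log (rankOneSphericalIntegral θ (E N)) =
      1 / (N : ℝ) * Real.log (expMean 𝕜 (hE N).eigenvalues θ j) := by
    filter_upwards [eventually_gt_atTop 0] with N hN0
    exact ⟨⟨0, hN0⟩, by rw [rankOneSphericalIntegral_eq_expMean θ (hE N) ⟨0, hN0⟩ rfl]⟩
  have hcongr : ∀ {c : ℝ} {g : ℝ → ℝ}, (∀ x, 1 + 2 / β * θ * v - 2 / β * θ * x = g x) →
      θ * v = c → ((∀ᵐ x ∂(μ : Measure ℝ), 0 < g x) ∧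
        Integrable (fun x => Real.log (g x)) (μ : Measure ℝ) ∧
        Tendsto (fun N : ℕ => 1 / (N : ℝ) * Real.log (rankOneSphericalIntegral θ (E N))) atTop
          (𝓝 (c - β / 2 * ∫ x, Real.log (g x) ∂(μ : Measure ℝ)))) →
      (∀ᵐ x ∂(μ : Measure ℝ), 0 < 1 + 2 / β * θ * v - 2 / β * θ * x) ∧
        Integrable (fun x => Real.log (1 + 2 / β * θ * v - 2 / β * θ * x)) (μ : Measure ℝ) ∧
        Tendsto (fun N : ℕ => 1 / (N : ℝ) * Real.log (rankOneSphericalIntegral θ (E N))) atTop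
          (𝓝 (θ * v -
            β / 2 * ∫ x, Real.log (1 + 2 / β * θ * v - 2 / β * θ * x) ∂(μ : Measure ℝ))) := by
    intro c g hg hc h
    simp only [hg, hc]
    exact h
  rcases lt_trichotomy θ 0 with hθ | rfl | hθ
  -- Negative θ: reflect x to -x, so that -lMin plays the part of the top eigenvalue and v = -κ +
  -- 1/γ.
  · set γ := -(2 * θ / β) with hγdef
    have hγ : 0 < γ := neg_pos.2 (div_neg_of_neg_of_pos (by linarith) hβ0)
    have hγθ : 2 * θ / β = -γ := by rw [hγdef, neg_neg]
    have hθγ : β / 2 * γ = -θ := by rw [hγdef]; field_simp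
    obtain ⟨κ, hκ, hv⟩ : ∃ κ, IsSaddlePoint (μ : Measure ℝ) (fun x => -x) (-lMin) γ κ ∧
        v = -κ - (-γ)⁻¹ := by
      have hltMax : ((2 * θ / β : ℝ) : EReal) ≤ hMax := by
        rw [hγθ]
        exact (EReal.coe_neg'.2 (neg_neg_of_pos hγ)).le.trans hposR.le
      have hiff : hMin ≤ ((2 * θ / β : ℝ) : EReal) ↔ (γ : EReal) ≤ -hMin := by
        rw [hγθ, EReal.coe_neg, EReal.le_neg]
      rw [hhMin, neg_neg] at hiff
      by_cases hc : hMin ≤ ((2 * θ / β : ℝ) : EReal)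
      · obtain ⟨κ, hκ, hR⟩ := exists_rTransform_eq_left hμ hL' hγ (hiff.1 hc)
        refine ⟨κ, hκ, ?_⟩
        simp only [v, saddle]
        rw [if_pos ⟨hc, hltMax⟩, hγθ, hR]
      -- Below `hMin` the reflected Cauchy mean never reaches γ, so the saddle point sticks at the
      -- endpoint.
      · refine ⟨-lMin, Or.inr ⟨rfl, fun z hz => cauchyMean_lt_of_sSup_le measurable_neg hm' hL'
          (not_le.1 (mt hiff.2 hc)).le hz⟩, ?_⟩
        simp only [v, saddle]
        rw [if_neg fun h => hc h.1, if_neg (not_lt.2 hltMax), ← hγθ, neg_neg, inv_div]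
    have hfin := hκ.conclusion 𝕜 (l := fun N i => -(hE N).eigenvalues i) (L := -lMax)
      measurable_neg hconv'
      (fun δ hδ => by filter_upwards [hle δ hδ] with N hN i; linarith [hN i])
      (fun δ hδ => by filter_upwards [hge δ hδ] with N hN i; linarith [hN i])
      (fun δ hδ => by
        filter_upwards [hbot δ hδ] with N ⟨i, hi⟩
        exact ⟨i, by linarith⟩) hγ (by
        simpa only [← hβ, hθγ, expMean_neg] using hF)
    rw [← hβ] at hfin
    refine hcongr (fun x => ?_) ?_ hfin
    · have : 2 / β * θ = -γ := by rw [← hγθ]; ring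
      rw [this, hv]
      field_simp
      ring
    · rw [hv, ← neg_neg θ, ← hθγ]
      field_simp
      ring
  -- At θ = 0 the value of v is irrelevant: the logarithm's argument is 1 and the integral is 1.
  · refine hcongr (c := 0) (g := fun _ => 1) (fun x => by ring) (by ring) ⟨by simp, by simp, ?_⟩
    refine Tendsto.congr' ?_ tendsto_const_nhds
    filter_upwards [hF] with N ⟨j, hj⟩
    rw [hj, expMean_zero]
    simp
  · set γ := 2 * θ / β with hγdef
    have hγ : 0 < γ := div_pos (by linarith) hβ0
    have hθγ : β / 2 * γ = θ := by rw [hγdef]; field_simp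
    obtain ⟨κ, hκ, hv⟩ : ∃ κ, IsSaddlePoint (μ : Measure ℝ) (fun x => x) lMax γ κ ∧
        v = κ - γ⁻¹ := by
      have hltMin : hMin ≤ (γ : EReal) := by
        rw [hhMin, EReal.neg_le]
        exact (EReal.neg_le.2 (by simpa using hγ.le)).trans hposL.le
      by_cases hc : (γ : EReal) ≤ hMax
      · obtain ⟨κ, hκ, hR⟩ := exists_rTransform_eq_right hμ hm hγ hc
        refine ⟨κ, hκ, ?_⟩
        simp only [v, saddle]
        rw [← hγdef, if_pos ⟨hltMin, hc⟩, hR]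
      · refine ⟨lMax, Or.inr ⟨rfl, fun z hz => cauchyMean_lt_of_sSup_le measurable_id hL hm
          (not_le.1 hc).le hz⟩, ?_⟩
        simp only [v, saddle]
        rw [← hγdef, if_neg fun h => hc h.2, if_pos (not_le.1 hc), hγdef, inv_div]
    have hfin := hκ.conclusion 𝕜 (l := fun N i => (hE N).eigenvalues i) (L := lMin)
      (X := fun x => x) measurable_id hconv hge hle htop hγ (by
        simpa only [← hβ, hθγ] using hF)
    rw [← hβ] at hfin
    refine hcongr (fun x => ?_) ?_ hfin
    · have : 2 / β * θ = γ := by rw [hγdef]; ring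
      rw [this, hv]
      field_simp
      ring
    · rw [hv, ← hθγ]
      field_simp
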